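/- Let $(S,\mu)$ be a measurable space with a nonzero measure, $X_1,\dots,X_n$ measurable real functions on $S$, and $\Theta\subseteq\mathbb R^n$ an open set with $\int_S e^{-\sum_j\theta^jX_j}\,d\mu<\infty$ for all $\theta\in\Theta$. Put $\Phi(\theta)=\log\int_S e^{-\sum_j\theta^jX_j}\,d\mu$. On the manifold $M=\Theta$ of the probability densities $e^{-\sum_j\theta^jX_j-\Phi(\theta)}$ let $g_{ij}=\partial_i\partial_j\Phi$ and $t_{ijk}=\partial_i\partial_j\partial_k\Phi$. Assume that $M$ is an *information geometry Frobenius manifold*: $g$ is nondegenerate on $\Theta$, and the commutative multiplication $\circ$ on each tangent space $T_\theta M$ given by $g(u\circ v,w)=t(u,v,w)$ is associative (equivalently, $\Phi$ satisfies the WDVV equations $\Phi_{abe}g^{ef}\Phi_{fcd}=\Phi_{bce}g^{ef}\Phi_{fad}$). Let $\partial^i=g^{ij}\partial_j$ be the basis of $T_\theta M$ that is $g$-dual to $\partial_1,\dots,\partial_n$, and let $b^{ij}_k(\theta)$ be the structure constants of the Frobenius algebra $(T_\theta M,\circ,g)$ in this basis: $\partial^i\circ\partial^j=b^{ij}_k\,\partial^k$.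 For an open $U\subseteq\mathbb R^n$ consider the smooth fields $u:\mathbb R/\mathbb Z\to U$. A *smooth functional* is a real function $F$ of such fields that has a variational derivative $\delta F/\delta u$ (a smooth $\mathbb R^n$-valued function on the circle for each $u$), such that along every family $u_\varepsilon(x)$ of fields, smooth in $(\varepsilon,x)$ with $\varepsilon$ in an open subset of some $\mathbb R^m$, $F(u_\varepsilon)$ is smooth in $\varepsilon$, $(\delta F/\delta u)(u_\varepsilon)(x)$ is smooth in $(\varepsilon,x)$, and $\partial_\varepsilon F(u_\varepsilon)=\int_0^1\sum_i\frac{\delta F}{\delta u^i}\,\partial_\varepsilon u^i_\varepsilon\,dx$. Smooth functionals form a commutative algebra under pointwise operations. A *Poisson bracket of hydrodynamic type* $$\{u^i(x),u^j(y)\}=h^{ij}(u(x))\,\delta'(x-y)+b^{ij}_k(u(x))\,\frac{\partial u^k}{\partial x}\,\delta(x-y)$$ is a bilinear, alternating bracket on this algebra that satisfies the Jacobi identity and the Leibniz rule and is given by $$\{F,G\}(u)=\int_0^1\sum_{i,j}\frac{\delta F}{\delta u^i}\Big(h^{ij}(u)\frac{\partial}{\partial x}+b^{ij}_k(u)\frac{\partial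 u^k}{\partial x}\Big)\frac{\delta G}{\delta u^j}\,dx .$$ Then the information geometry Frobenius manifold $M$ admits Poisson brackets of hydrodynamic type whose tensors $b^{ij}_k$ are the structure constants of the Frobenius algebras on its tangent spaces: 1. for fields with values in $M=\Theta$, there is a Poisson bracket of hydrodynamic type with $h^{ij}(\theta)=-2g^{ij}(\theta)$ and with the structure constants $b^{ij}_k(\theta)$ of $T_\theta M$; 2. for each point $p\in M$ and each $s\in\mathbb R$, for fields $w$ with values in $T_pM\cong\mathbb R^n$, there is a Poisson bracket of hydrodynamic type with $h^{ij}(w)=\big(b^{ij}_k(p)+b^{ji}_k(p)\big)w^k+s\,g^{ij}(p)$ and with the constant tensor $b^{ij}_k(p)$. -/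

import Mathlib

open scoped ContDiff

namespace InfoFrobenius

/-! ### Exponential families as Frobenius manifolds -/

section Geometry

variable {n : ℕ}

/-- The partial derivative `∂_i f` in the standard coordinates of `ℝⁿ`. -/
noncomputable def pd (i : Fin n) (f : (Fin n → ℝ) → ℝ) (θ : Fin n → ℝ) : ℝ :=
  fderiv ℝ f θ (Pi.single i 1)

/-- The logarithm `Φ(θ) = log ∫ exp (-∑ θʲ X_j(s)) μ(ds)` of the partition function of the
exponential family with reference measure `μ` and directional statistics `X_1, …, X_n`. -/
noncomputable def logPartition {S : Type*} [MeasurableSpace S] (μ : MeasureTheory.Measure S)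
    (X : Fin n → S → ℝ) (θ : Fin n → ℝ) : ℝ :=
  Real.log (∫ s, Real.exp (-∑ j, θ j * X j s) ∂μ)

/-- The Hessian metric `g_{ij} = ∂_i ∂_j Φ` of a potential `Φ`. -/
noncomputable def metric (Φ : (Fin n → ℝ) → ℝ) (θ : Fin n → ℝ) : Matrix (Fin n) (Fin n) ℝ :=
  Matrix.of fun i j => pd i (pd j Φ) θ

/-- The rank three tensor `t_{ijk} = ∂_i ∂_j ∂_k Φ` of a potential `Φ`. -/
noncomputable def cubic (Φ : (Fin n → ℝ) → ℝ) (θ : Fin n → ℝ) (i j k : Fin n) : ℝ :=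
  pd i (pd j (pd k Φ)) θ

/-- The multiplication `∘` on the tangent space `T_θ = ℝⁿ` at `θ`:
`(v ∘ w)^k = v^i w^j t_{ijl} g^{lk}`. -/
noncomputable def tmul (Φ : (Fin n → ℝ) → ℝ) (θ v w : Fin n → ℝ) : Fin n → ℝ := fun k =>
  ∑ i, ∑ j, ∑ l, v i * w j * cubic Φ θ i j l * (metric Φ θ)⁻¹ l k

/-- The multiplication is the one determined by `g(v ∘ w, z) = t(v, w, z)`. -/
theorem metric_tmul (Φ : (Fin n → ℝ) → ℝ) (θ v w : Fin n → ℝ)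
    (hg : (metric Φ θ).det ≠ 0) (m : Fin n) :
    ∑ k, tmul Φ θ v w k * metric Φ θ k m = ∑ i, ∑ j, v i * w j * cubic Φ θ i j m := by
  have key : ∀ l, ∑ k, (metric Φ θ)⁻¹ l k * metric Φ θ k m = if l = m then 1 else 0 := by
    intro l
    have := congrFun (congrFun (Matrix.nonsing_inv_mul (metric Φ θ) (isUnit_iff_ne_zero.mpr hg)) l) m
    rw [Matrix.mul_apply, Matrix.one_apply] at this
    exact this
  simp only [tmul, Finset.sum_mul]
  rw [Finset.sum_comm]
  refine Finset.sum_congr rfl fun i _ => ?_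
  rw [Finset.sum_comm]
  refine Finset.sum_congr rfl fun j _ => ?_
  rw [Finset.sum_comm]
  simp only [mul_assoc, ← Finset.mul_sum, key]
  simp

/-- The basis `∂^i = g^{ij} ∂_j` of the tangent space at `θ`; it is dual to `∂_1, …, ∂_n` with
respect to `g`, and it is the coordinate frame `∂/∂η_i` of the dual coordinates `η_i = ∂_i Φ`. -/
noncomputable def dualFrame (Φ : (Fin n → ℝ) → ℝ) (θ : Fin n → ℝ) (i : Fin n) : Fin n → ℝ :=
  fun j => (metric Φ θ)⁻¹ i j

/-- The information geometry Frobenius manifold: the exponential family with densities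
`exp (-∑ θʲ X_j - Φ(θ))` with respect to `μ`, where `θ` runs through the open set `Θ`, such that
`g = Hess Φ` is nondegenerate and the multiplication on the tangent spaces that is defined by
`g(u ∘ v, w) = t(u, v, w)`, with `t_{abc} = ∂_a ∂_b ∂_c Φ`, is associative (the WDVV equations
for `Φ`). -/
structure IsInformationFrobeniusManifold {S : Type*} [MeasurableSpace S]
    (μ : MeasureTheory.Measure S) (X : Fin n → S → ℝ) (Θ : Set (Fin n → ℝ)) : Prop where
  measure_ne_zero : μ ≠ 0
  measurable : ∀ j, Measurable (X j)
  isOpen : IsOpen Θ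
  integrable : ∀ θ ∈ Θ, MeasureTheory.Integrable (fun s => Real.exp (-∑ j, θ j * X j s)) μ
  nondegenerate : ∀ θ ∈ Θ, (metric (logPartition μ X) θ).det ≠ 0
  associative : ∀ θ ∈ Θ, ∀ u v w : Fin n → ℝ,
    tmul (logPartition μ X) θ (tmul (logPartition μ X) θ u v) w =
      tmul (logPartition μ X) θ u (tmul (logPartition μ X) θ v w)

end Geometry

/-! ### Functionals of fields on the circle -/

section Functionals

variable {n : ℕ}

/-- A field `x ↦ u(x)` on the circle `ℝ/ℤ`: a smooth `1`-periodic map `ℝ → ℝⁿ` with values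
in `U`. -/
structure Field (U : Set (Fin n → ℝ)) where
  toFun : ℝ → Fin n → ℝ
  smooth : ContDiff ℝ ∞ toFun
  periodic : Function.Periodic toFun 1
  mem : ∀ x, toFun x ∈ U

instance (U : Set (Fin n → ℝ)) : CoeFun (Field U) fun _ => ℝ → Fin n → ℝ := ⟨Field.toFun⟩

/-- A family of fields, parametrized by the points `ε` of the open set `W` of `ℝᵐ`, is smooth
if it is jointly smooth in `(ε, x)`. -/
def IsSmoothFamily {U : Set (Fin n → ℝ)} {m : ℕ} (W : Set (Fin m → ℝ))
    (v : (Fin m → ℝ) → Field U) : Prop :=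
  ContDiffOn ℝ ∞ (fun q : (Fin m → ℝ) × ℝ => v q.1 q.2) (W ×ˢ Set.univ)

/-- `F` is a smooth functional with variational derivative `δ = δF/δu`: along every smooth
finite-dimensional family of fields `v_ε`, both `F` and `δ` are smooth, and
`∂F(v_ε)/∂ε = ∫ ∑ᵢ (δF/δuⁱ)(x) ∂v_εⁱ(x)/∂ε dx`. -/
structure IsVariationalDerivative {U : Set (Fin n → ℝ)} (F : Field U → ℝ)
    (δ : Field U → Field (Set.univ : Set (Fin n → ℝ))) : Prop where
  smooth : ∀ (m : ℕ) (W : Set (Fin m → ℝ)) (v : (Fin m → ℝ) → Field U), IsOpen W →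
    IsSmoothFamily W v → ContDiffOn ℝ ∞ (fun ε => F (v ε)) W
  smooth_grad : ∀ (m : ℕ) (W : Set (Fin m → ℝ)) (v : (Fin m → ℝ) → Field U), IsOpen W →
    IsSmoothFamily W v → IsSmoothFamily W (fun ε => δ (v ε))
  fderiv_eq : ∀ (m : ℕ) (W : Set (Fin m → ℝ)) (v : (Fin m → ℝ) → Field U), IsOpen W →
    IsSmoothFamily W v → ∀ ε ∈ W, ∀ e : Fin m → ℝ,
      fderiv ℝ (fun ε' => F (v ε')) ε e =
        ∫ x in (0 : ℝ)..1, ∑ i, δ (v ε) x i * fderiv ℝ (fun ε' => v ε' x i) ε e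

theorem IsSmoothFamily.continuous_fderiv {U : Set (Fin n → ℝ)} {m : ℕ} {W : Set (Fin m → ℝ)}
    {v : (Fin m → ℝ) → Field U} (hW : IsOpen W) (hv : IsSmoothFamily W v)
    {ε : Fin m → ℝ} (hε : ε ∈ W) (e : Fin m → ℝ) (i : Fin n) :
    Continuous fun x => fderiv ℝ (fun ε' => v ε' x i) ε e := by
  have hO : IsOpen (W ×ˢ (Set.univ : Set ℝ)) := hW.prod isOpen_univ
  have hvi : ContDiffOn ℝ ∞ (fun q : (Fin m → ℝ) × ℝ => v q.1 q.2 i) (W ×ˢ Set.univ) :=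
    contDiffOn_pi.mp hv i
  have h1 : ∀ x : ℝ, fderiv ℝ (fun ε' => v ε' x i) ε e =
      fderiv ℝ (fun q : (Fin m → ℝ) × ℝ => v q.1 q.2 i) (ε, x) (e, 0) := by
    intro x
    have hd : HasFDerivAt (fun q : (Fin m → ℝ) × ℝ => v q.1 q.2 i)
        (fderiv ℝ (fun q : (Fin m → ℝ) × ℝ => v q.1 q.2 i) (ε, x)) (ε, x) :=
      ((hvi.differentiableOn (by simp)).differentiableAt
        (hO.mem_nhds ⟨hε, Set.mem_univ x⟩)).hasFDerivAt
    have hc := HasFDerivAt.comp (f := fun ε' : Fin m → ℝ => (ε', x)) ε hd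
      ((hasFDerivAt_id ε).prodMk (hasFDerivAt_const x ε))
    have := hc.fderiv
    simp only [Function.comp_def] at this
    rw [this]
    simp
  simp only [h1]
  have hcf := (hvi.continuousOn_fderiv_of_isOpen hO (by simp))
  have : Continuous fun x : ℝ =>
      fderiv ℝ (fun q : (Fin m → ℝ) × ℝ => v q.1 q.2 i) (ε, x) :=
    hcf.comp_continuous (by fun_prop) fun x => ⟨hε, Set.mem_univ x⟩
  exact this.clm_apply continuous_const

theorem IsSmoothFamily.intervalIntegrable {U : Set (Fin n → ℝ)} {m : ℕ} {W : Set (Fin m → ℝ)}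
    {v : (Fin m → ℝ) → Field U} (hW : IsOpen W) (hv : IsSmoothFamily W v)
    {ε : Fin m → ℝ} (hε : ε ∈ W) (e : Fin m → ℝ) (a : Field (Set.univ : Set (Fin n → ℝ))) :
    IntervalIntegrable (fun x => ∑ i, a x i * fderiv ℝ (fun ε' => v ε' x i) ε e)
      MeasureTheory.volume 0 1 := by
  refine Continuous.intervalIntegrable (continuous_finsetSum _ fun i _ => ?_) _ _
  exact ((continuous_apply i).comp a.smooth.continuous).mul (hv.continuous_fderiv hW hε e i)

/-- The algebra, under pointwise operations, of the smooth functionals of fields with values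
in `U`. -/
def smoothFunctionals (U : Set (Fin n → ℝ)) : Subalgebra ℝ (Field U → ℝ) where
  carrier := {F | ∃ δ, IsVariationalDerivative F δ}
  algebraMap_mem' c := by
    refine ⟨fun _ => ⟨fun _ => 0, contDiff_const, fun _ => rfl, fun _ => Set.mem_univ _⟩, ?_, ?_, ?_⟩
    · intro m W v _ _
      exact contDiffOn_const
    · intro m W v _ _
      exact contDiffOn_const
    · intro m W v _ _ ε _ e
      simp
  add_mem' := by
    rintro F G ⟨δ, hF⟩ ⟨γ, hG⟩
    refine ⟨fun u => ⟨fun x => δ u x + γ u x, (δ u).smooth.add (γ u).smooth, ?_,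
      fun _ => Set.mem_univ _⟩, ?_, ?_, ?_⟩
    · intro x
      simp only [(δ u).periodic x, (γ u).periodic x]
    · intro m W v hW hv
      exact (hF.smooth m W v hW hv).add (hG.smooth m W v hW hv)
    · intro m W v hW hv
      exact ContDiffOn.add (hF.smooth_grad m W v hW hv) (hG.smooth_grad m W v hW hv)
    · intro m W v hW hv ε hε e
      have d1 := ((hF.smooth m W v hW hv).differentiableOn (by simp)).differentiableAt
        (hW.mem_nhds hε)
      have d2 := ((hG.smooth m W v hW hv).differentiableOn (by simp)).differentiableAt
        (hW.mem_nhds hε)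
      have := fderiv_fun_add d1 d2
      simp only [Pi.add_apply]
      rw [this, add_apply, hF.fderiv_eq m W v hW hv ε hε e,
        hG.fderiv_eq m W v hW hv ε hε e,
        ← intervalIntegral.integral_add (hv.intervalIntegrable hW hε e _)
          (hv.intervalIntegrable hW hε e _)]
      simp only [add_mul, Finset.sum_add_distrib]
  mul_mem' := by
    rintro F G ⟨δ, hF⟩ ⟨γ, hG⟩
    refine ⟨fun u => ⟨fun x => F u • γ u x + G u • δ u x,
      ((γ u).smooth.const_smul (F u)).add ((δ u).smooth.const_smul (G u)), ?_,
      fun _ => Set.mem_univ _⟩, ?_, ?_, ?_⟩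
    · intro x
      simp only [(δ u).periodic x, (γ u).periodic x]
    · intro m W v hW hv
      exact (hF.smooth m W v hW hv).mul (hG.smooth m W v hW hv)
    · intro m W v hW hv
      have p1 : ContDiffOn ℝ ∞ (fun q : (Fin m → ℝ) × ℝ => F (v q.1)) (W ×ˢ Set.univ) :=
        (hF.smooth m W v hW hv).comp contDiff_fst.contDiffOn fun q hq => hq.1
      have p2 : ContDiffOn ℝ ∞ (fun q : (Fin m → ℝ) × ℝ => G (v q.1)) (W ×ˢ Set.univ) :=
        (hG.smooth m W v hW hv).comp contDiff_fst.contDiffOn fun q hq => hq.1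
      exact (p1.smul (hG.smooth_grad m W v hW hv)).add (p2.smul (hF.smooth_grad m W v hW hv))
    · intro m W v hW hv ε hε e
      have d1 := ((hF.smooth m W v hW hv).differentiableOn (by simp)).differentiableAt
        (hW.mem_nhds hε)
      have d2 := ((hG.smooth m W v hW hv).differentiableOn (by simp)).differentiableAt
        (hW.mem_nhds hε)
      have := fderiv_fun_mul d1 d2
      simp only [Pi.mul_apply]
      rw [this, add_apply, smul_apply, smul_apply, hF.fderiv_eq m W v hW hv ε hε e,
        hG.fderiv_eq m W v hW hv ε hε e, smul_eq_mul, smul_eq_mul,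
        ← intervalIntegral.integral_const_mul, ← intervalIntegral.integral_const_mul,
        ← intervalIntegral.integral_add ((hv.intervalIntegrable hW hε e _).const_mul _)
          ((hv.intervalIntegrable hW hε e _).const_mul _)]
      simp only [Pi.add_apply, Pi.smul_apply, smul_eq_mul, add_mul, Finset.sum_add_distrib,
        Finset.mul_sum, mul_assoc]

/-- A Poisson bracket on a commutative real algebra: a Lie bracket that is a derivation in each
argument. -/
structure IsPoissonBracket {A : Type*} [CommRing A] [Algebra ℝ A] (br : A →ₗ[ℝ] A →ₗ[ℝ] A) :
    Prop where
  alternating : ∀ a, br a a = 0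
  jacobi : ∀ a b c, br (br a b) c + br (br b c) a + br (br c a) b = 0
  leibniz : ∀ a b c, br a (b * c) = br a b * c + b * br a c

/-- The bracket `br` has the hydrodynamic type form
`{uⁱ(x), uʲ(y)} = hⁱʲ(u(x)) δ'(x - y) + bⁱʲ_k(u(x)) (∂uᵏ/∂x) δ(x - y)`, that is,
`{F, G} = ∬ ∑ᵢⱼ (δF/δuⁱ)(x) {uⁱ(x), uʲ(y)} (δG/δuʲ)(y) dx dy`
`       = ∫ ∑ᵢⱼ (δF/δuⁱ) (hⁱʲ(u) ∂/∂x + bⁱʲ_k(u) ∂uᵏ/∂x) (δG/δuʲ) dx`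
for all smooth functionals `F` and `G`. -/
def IsHydrodynamicType {U : Set (Fin n → ℝ)} (h : (Fin n → ℝ) → Matrix (Fin n) (Fin n) ℝ)
    (b : (Fin n → ℝ) → Fin n → Fin n → Fin n → ℝ)
    (br : smoothFunctionals U →ₗ[ℝ] smoothFunctionals U →ₗ[ℝ] smoothFunctionals U) : Prop :=
  ∀ (F G : smoothFunctionals U) (δF δG : Field U → Field (Set.univ : Set (Fin n → ℝ))),
    IsVariationalDerivative (F : Field U → ℝ) δF →
    IsVariationalDerivative (G : Field U → ℝ) δG →
    ∀ u : Field U, (br F G : Field U → ℝ) u =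
      ∫ x in (0 : ℝ)..1, ∑ i, ∑ j, δF u x i *
        (h (u x) i j * deriv (fun y => δG u y j) x +
          ∑ k, b (u x) i j k * deriv (fun y => u y k) x * δG u x j)

end Functionals

end InfoFrobenius

/-! Both brackets are instances of one construction. Let `h` be symmetric with `∂_k hⁱʲ = 2 bⁱʲ_k`,
and let `bⁱʲ_l hˡᵐ` and `bⁱʲ_l bˡᵐ_k` be totally symmetric in `i, j, m` (`IsHydrodynamicData`).
Write `P = h ∂ₓ + b uₓ`. Since `∂ₓ h(u) = 2 b uₓ`, the operator `P` is skew-adjoint (`pair_ham`), so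
with `a = δF`, `c = δG` the bracket equals `∫ ½ hⁱʲ (a_i c_j' - a_i' c_j)`. This form is
alternating, and the Leibniz rule follows from that of the gradient.

For the Jacobi identity, varying `u` in this form gives the gradient `F''(P c) - G''(P a) + T(a,
c)`, where `F''`, `G''` are the second variations and `T_l = bⁱʲ_l (a_i c_j' - a_i' c_j)` comes from
the variation of `h` (`isVariationalDerivative_bracket`). In the cyclic sum of the double brackets
the second variations cancel because they are symmetric, by equality of mixed partials
(`pair_secondVar_comm`). What remains is the cyclic sum of `∫ T(a, c) · P e`, whose integrand
vanishes pointwise by the two total symmetries (`cyclic_sum_eq_zero`).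

It remains to find such data on the manifold. Differentiating `g⁻¹ g = 1` gives `∂_k gⁱʲ = -bⁱʲ_k`
(`pd_inv_metric`), which is why `-2 g⁻¹` appears. The tensor `bⁱʲ_l gˡᵐ` is `t` with all indices
raised, hence symmetric, and the symmetry of `bⁱʲ_l bˡᵐ_k` is associativity together with
commutativity (`structureConst_assoc`). At a fixed point `p` the affine tensor `(b + bᵀ) w + s g⁻¹`
has derivative `2b`, and its product with `b` combines the same two symmetric tensors. All this
needs `Φ` to be smooth, which holds because a Laplace transform may be differentiated under the
integral inside its domain. -/

namespace InfoFrobenius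

open MeasureTheory Topology

/-! ### Directional derivatives and integrals depending on parameters. -/

section Calculus

variable {E : Type*} [NormedAddCommGroup E] [NormedSpace ℝ E]

/-- The derivative of `f` in the direction `z`. -/
noncomputable def dd (z : E) (f : E → ℝ) (q : E) : ℝ := fderiv ℝ f q z

/-- Induction on the order of differentiability: in finite dimension it suffices to control the
derivative on each vector `z`. It reduces smoothness of parameter integrals to one differentiation
under the integral sign, applied to a class closed under that operation. -/
theorem contDiffOn_infty_of_fderiv_mem [FiniteDimensional ℝ E] {O : Set E} (hO : IsOpen O)
    (C : Set (E → ℝ))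
    (hC : ∀ G ∈ C, DifferentiableOn ℝ G O ∧ ∀ z, ∃ G' ∈ C, ∀ x ∈ O, fderiv ℝ G x z = G' x)
    {G : E → ℝ} (hG : G ∈ C) : ContDiffOn ℝ ∞ G O := by
  rw [contDiffOn_infty]
  intro k
  induction k generalizing G with
  | zero => exact contDiffOn_zero.mpr (hC G hG).1.continuousOn
  | succ k ih =>
    have : ((k + 1 : ℕ) : WithTop ℕ∞) = (k : WithTop ℕ∞) + 1 := by push_cast; rfl
    rw [this, contDiffOn_succ_iff_fderiv_of_isOpen hO]
    refine ⟨(hC G hG).1, by simp, contDiffOn_clm_apply.mpr fun z => ?_⟩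
    obtain ⟨G', hG', h⟩ := (hC G hG).2 z
    exact (ih hG').congr h

variable {O : Set E} {f g : E → ℝ} {q : E}

theorem differentiableAt_of_smooth {F : Type*} [NormedAddCommGroup F] [NormedSpace ℝ F]
    {f : E → F} (hO : IsOpen O) (hf : ContDiffOn ℝ ∞ f O) (hq : q ∈ O) :
    DifferentiableAt ℝ f q :=
  (hf.differentiableOn (by simp)).differentiableAt (hO.mem_nhds hq)

theorem dd_contDiffOn (hO : IsOpen O) (hf : ContDiffOn ℝ ∞ f O) (z : E) :
    ContDiffOn ℝ ∞ (dd z f) O :=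
  (hf.fderiv_of_isOpen hO (by simp)).clm_apply contDiffOn_const

theorem dd_congr (hO : IsOpen O) (h : Set.EqOn f g O) (hq : q ∈ O) (z : E) :
    dd z f q = dd z g q := by
  unfold dd
  rw [Filter.EventuallyEq.fderiv_eq (Filter.eventuallyEq_of_mem (hO.mem_nhds hq) h)]

theorem dd_comm (hO : IsOpen O) (hf : ContDiffOn ℝ ∞ f O) (hq : q ∈ O) (z w : E) :
    dd z (dd w f) q = dd w (dd z f) q := by
  have hs : IsSymmSndFDerivAt ℝ f q :=
    (hf.contDiffAt (hO.mem_nhds hq)).isSymmSndFDerivAt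
      (by simpa using WithTop.coe_le_coe.mpr (le_top (a := (2 : ℕ∞))))
  have hd : DifferentiableAt ℝ (fderiv ℝ f) q :=
    differentiableAt_of_smooth hO (hf.fderiv_of_isOpen hO (by simp)) hq
  have key : ∀ a b : E, dd a (dd b f) q = fderiv ℝ (fderiv ℝ f) q a b := by
    intro a b
    change fderiv ℝ (fun y => fderiv ℝ f y b) q a = _
    rw [fderiv_clm_apply hd (differentiableAt_const b)]
    simp
  rw [key, key]
  exact hs z w

theorem dd_mul (hO : IsOpen O) (hf : ContDiffOn ℝ ∞ f O) (hg : ContDiffOn ℝ ∞ g O) (hq : q ∈ O)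
    (z : E) : dd z (fun x => f x * g x) q = dd z f q * g q + f q * dd z g q := by
  unfold dd
  rw [fderiv_fun_mul (differentiableAt_of_smooth hO hf hq) (differentiableAt_of_smooth hO hg hq)]
  simp only [add_apply, smul_apply, smul_eq_mul]
  ring

theorem dd_sub (hO : IsOpen O) (hf : ContDiffOn ℝ ∞ f O) (hg : ContDiffOn ℝ ∞ g O) (hq : q ∈ O)
    (z : E) : dd z (fun x => f x - g x) q = dd z f q - dd z g q := by
  unfold dd
  rw [fderiv_fun_sub (differentiableAt_of_smooth hO hf hq) (differentiableAt_of_smooth hO hg hq)]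
  rfl

theorem dd_const_mul (hO : IsOpen O) (hf : ContDiffOn ℝ ∞ f O) (hq : q ∈ O) (c : ℝ)
    (z : E) : dd z (fun x => c * f x) q = c * dd z f q := by
  unfold dd
  rw [fderiv_const_mul (differentiableAt_of_smooth hO hf hq)]
  rfl

theorem dd_sum {ι : Type*} [Fintype ι] {f : ι → E → ℝ} (hO : IsOpen O)
    (hf : ∀ i, ContDiffOn ℝ ∞ (f i) O) (hq : q ∈ O) (z : E) :
    dd z (fun x => ∑ i, f i x) q = ∑ i, dd z (f i) q := by
  unfold dd
  rw [fderiv_fun_sum fun i _ => differentiableAt_of_smooth hO (hf i) hq]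
  simp

/-- The derivative of a composition, in coordinates. -/
theorem dd_comp_pi {n : ℕ} {U : Set (Fin n → ℝ)} {h : (Fin n → ℝ) → ℝ} {v : E → Fin n → ℝ}
    (hO : IsOpen O) (hU : IsOpen U) (hh : ContDiffOn ℝ ∞ h U) (hv : ContDiffOn ℝ ∞ v O)
    (hq : q ∈ O) (hqU : v q ∈ U) (z : E) :
    dd z (fun x => h (v x)) q = ∑ k, pd k h (v q) * dd z (fun x => v x k) q := by
  have hd := differentiableAt_of_smooth hU hh hqU
  have hvd := differentiableAt_of_smooth hO hv hq
  have h1 : dd z (fun x => h (v x)) q = fderiv ℝ h (v q) (fderiv ℝ v q z) := by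
    unfold dd
    rw [fderiv_fun_comp (f := v) q hd hvd]
    rfl
  have h2 : ∀ k, dd z (fun x => v x k) q = fderiv ℝ v q z k := by
    intro k
    have := ((hasFDerivAt_pi'.mp hvd.hasFDerivAt) k).fderiv
    unfold dd
    rw [this]
    rfl
  rw [h1]
  conv_lhs => rw [pi_eq_sum_univ' (fderiv ℝ v q z)]
  simp only [map_sum, map_smul, smul_eq_mul, h2, pd]
  refine Finset.sum_congr rfl fun k _ => ?_
  rw [mul_comm]

/-! #### Functions on a product with the line -/

variable {F : E × ℝ → ℝ}

theorem hasFDerivAt_slice (hO : IsOpen O) (hF : ContDiffOn ℝ ∞ F (O ×ˢ Set.univ)) (hq : q ∈ O)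
    (x : ℝ) : HasFDerivAt (fun ε => F (ε, x))
      ((fderiv ℝ F (q, x)).comp (ContinuousLinearMap.inl ℝ E ℝ)) q := by
  have hd := (differentiableAt_of_smooth (hO.prod isOpen_univ) hF
    (q := (q, x)) ⟨hq, Set.mem_univ x⟩).hasFDerivAt
  exact HasFDerivAt.comp (f := fun ε : E => (ε, x)) q hd (hasFDerivAt_prodMk_left q x)

theorem fderiv_slice (hO : IsOpen O) (hF : ContDiffOn ℝ ∞ F (O ×ˢ Set.univ)) (hq : q ∈ O)
    (x : ℝ) (e : E) : fderiv ℝ (fun ε => F (ε, x)) q e = dd (e, 0) F (q, x) := by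
  rw [(hasFDerivAt_slice hO hF hq x).fderiv]
  simp [dd]

theorem hasDerivAt_slice (hO : IsOpen O) (hF : ContDiffOn ℝ ∞ F (O ×ˢ Set.univ)) (hq : q ∈ O)
    (x : ℝ) : HasDerivAt (fun y => F (q, y)) (dd (0, 1) F (q, x)) x := by
  have hd := (differentiableAt_of_smooth (hO.prod isOpen_univ) hF
    (q := (q, x)) ⟨hq, Set.mem_univ x⟩).hasFDerivAt
  have := (HasFDerivAt.comp (f := fun y : ℝ => (q, y)) x hd (hasFDerivAt_prodMk_right q x)).hasDerivAt
  have h : (fderiv ℝ F (q, x)).comp (ContinuousLinearMap.inr ℝ E ℝ) 1 = dd (0, 1) F (q, x) := by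
    simp [dd]
  rw [← h]
  exact this

theorem contDiff_slice (hF : ContDiffOn ℝ ∞ F (O ×ˢ Set.univ)) (hq : q ∈ O) :
    ContDiff ℝ ∞ fun x => F (q, x) := by
  rw [← contDiffOn_univ]
  exact hF.comp (f := fun x : ℝ => (q, x)) (by fun_prop) fun x _ => ⟨hq, Set.mem_univ x⟩

/-- The dominating constant is the maximum of the partial derivative over a compact ball times `[0,
1]`. -/
theorem hasFDerivAt_integral [FiniteDimensional ℝ E] (hO : IsOpen O)
    (hF : ContDiffOn ℝ ∞ F (O ×ˢ Set.univ)) (hq : q ∈ O) :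
    HasFDerivAt (fun ε => ∫ x in (0 : ℝ)..1, F (ε, x))
      (∫ x in (0 : ℝ)..1, (fderiv ℝ F (q, x)).comp (ContinuousLinearMap.inl ℝ E ℝ)) q := by
  have : ProperSpace E := FiniteDimensional.proper_real E
  obtain ⟨r, hr, hrO⟩ := Metric.nhds_basis_closedBall.mem_iff.mp (hO.mem_nhds hq)
  have hcont : ContinuousOn
      (fun y : E × ℝ => (fderiv ℝ F y).comp (ContinuousLinearMap.inl ℝ E ℝ)) (O ×ˢ Set.univ) :=
    (hF.continuousOn_fderiv_of_isOpen (hO.prod isOpen_univ) (by simp)).clm_comp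
      continuousOn_const
  obtain ⟨C, hC⟩ := ((isCompact_closedBall q r).prod
    (isCompact_Icc (a := (0 : ℝ)) (b := 1))).exists_bound_of_continuousOn
    (hcont.mono (Set.prod_mono hrO (Set.subset_univ _)))
  refine intervalIntegral.hasFDerivAt_integral_of_dominated_of_fderiv_le
    (F' := fun ε x => (fderiv ℝ F (ε, x)).comp (ContinuousLinearMap.inl ℝ E ℝ))
    (bound := fun _ => C) (Metric.closedBall_mem_nhds q hr) ?_ ?_ ?_ ?_ ?_ ?_
  · filter_upwards [hO.mem_nhds hq] with ε hε
    exact (contDiff_slice hF hε).continuous.aestronglyMeasurable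
  · exact (contDiff_slice hF hq).continuous.intervalIntegrable _ _
  · exact (hcont.comp_continuous (f := fun x : ℝ => (q, x)) (by fun_prop)
      fun x => ⟨hq, Set.mem_univ x⟩).aestronglyMeasurable
  · refine Filter.Eventually.of_forall fun x hx ε hε => hC (ε, x) ⟨hε, ?_⟩
    rw [Set.uIoc_of_le zero_le_one] at hx
    exact ⟨hx.1.le, hx.2⟩
  · exact intervalIntegrable_const
  · exact Filter.Eventually.of_forall fun x _ ε hε => hasFDerivAt_slice hO hF (hrO hε) x

theorem fderiv_integral [FiniteDimensional ℝ E] (hO : IsOpen O)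
    (hF : ContDiffOn ℝ ∞ F (O ×ˢ Set.univ)) (hq : q ∈ O) (e : E) :
    fderiv ℝ (fun ε => ∫ x in (0 : ℝ)..1, F (ε, x)) q e =
      ∫ x in (0 : ℝ)..1, dd (e, 0) F (q, x) := by
  rw [(hasFDerivAt_integral hO hF hq).fderiv, ContinuousLinearMap.intervalIntegral_apply]
  · simp [dd]
  · have hcont : ContinuousOn
        (fun y : E × ℝ => (fderiv ℝ F y).comp (ContinuousLinearMap.inl ℝ E ℝ)) (O ×ˢ Set.univ) :=
      (hF.continuousOn_fderiv_of_isOpen (hO.prod isOpen_univ) (by simp)).clm_comp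
        continuousOn_const
    exact (hcont.comp_continuous (f := fun x : ℝ => (q, x)) (by fun_prop)
      fun x => ⟨hq, Set.mem_univ x⟩).intervalIntegrable _ _

theorem contDiffOn_integral [FiniteDimensional ℝ E] (hO : IsOpen O)
    (hF : ContDiffOn ℝ ∞ F (O ×ˢ Set.univ)) :
    ContDiffOn ℝ ∞ (fun ε => ∫ x in (0 : ℝ)..1, F (ε, x)) O := by
  refine contDiffOn_infty_of_fderiv_mem hO
    {G | ∃ F : E × ℝ → ℝ, ContDiffOn ℝ ∞ F (O ×ˢ Set.univ) ∧
      G = fun ε => ∫ x in (0 : ℝ)..1, F (ε, x)} ?_ (Exists.intro F ⟨hF, rfl⟩)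
  rintro _ ⟨F, hF, rfl⟩
  refine ⟨fun ε hε => (hasFDerivAt_integral hO hF hε).differentiableAt.differentiableWithinAt,
    fun z => ⟨fun ε => ∫ x in (0 : ℝ)..1, dd (z, 0) F (ε, x), ?_, fun ε hε => ?_⟩⟩
  · exact ⟨dd (z, 0) F, dd_contDiffOn (hO.prod isOpen_univ) hF _, rfl⟩
  · exact fderiv_integral hO hF hε z

theorem dd_periodic (hO : IsOpen O)
    (hp : ∀ ε ∈ O, ∀ x, F (ε, x + 1) = F (ε, x)) (hq : q ∈ O) (z : E × ℝ) (x : ℝ) :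
    dd z F (q, x + 1) = dd z F (q, x) := by
  have h1 : dd z F (q, x + 1) = dd z (fun y => F (y + (0, 1))) (q, x) := by
    unfold dd
    rw [fderiv_comp_add_right]
    simp
  rw [h1]
  refine dd_congr (q := (q, x)) (hO.prod isOpen_univ) ?_ ⟨hq, Set.mem_univ x⟩ z
  rintro ⟨ε, y⟩ ⟨hε, -⟩
  simpa using hp ε hε y

theorem integral_deriv_periodic {f f' : ℝ → ℝ} (hf : ∀ x, HasDerivAt f (f' x) x)
    (hf' : Continuous f') (hp : Function.Periodic f 1) : ∫ x in (0 : ℝ)..1, f' x = 0 := by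
  rw [intervalIntegral.integral_eq_sub_of_hasDerivAt (fun x _ => hf x)
    (hf'.intervalIntegrable _ _)]
  have := hp 0
  simp only [zero_add] at this
  rw [this, sub_self]

end Calculus

/-! ### First and second variations of functionals on the circle. -/

section Variations

variable {n : ℕ} {U : Set (Fin n → ℝ)}

/-- The smooth periodic covector fields along the circle. -/
abbrev Covector (n : ℕ) := Field (Set.univ : Set (Fin n → ℝ))

theorem Field.ext' {u v : Field U} (h : ∀ x, u x = v x) : u = v := by
  cases u; cases v
  congr
  exact funext h

theorem Field.smooth_coord (u : Field U) (i : Fin n) : ContDiff ℝ ∞ fun x => u x i :=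
  contDiff_pi.mp u.smooth i

theorem Field.continuous_coord (u : Field U) (i : Fin n) : Continuous fun x => u x i :=
  (u.smooth_coord i).continuous

/-- The `L²` pairing of covector fields along the circle. -/
noncomputable def pair (a φ : Covector n) : ℝ := ∫ x in (0 : ℝ)..1, ∑ i, a x i * φ x i

theorem pair_intervalIntegrable (a φ : Covector n) :
    IntervalIntegrable (fun x => ∑ i, a x i * φ x i) volume 0 1 :=
  (continuous_finsetSum _ fun i _ =>
    (a.continuous_coord i).mul (φ.continuous_coord i)).intervalIntegrable _ _

/-- Testing against `φ = a - b` makes the integral of `|φ|²` over a period vanish; by continuity and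
periodicity `φ = 0`. This is what makes gradients unique. -/
theorem pair_ext {a b : Covector n} (h : ∀ φ, pair a φ = pair b φ) : a = b := by
  let φ : Covector n := ⟨fun x => a x - b x, a.smooth.sub b.smooth,
    fun x => by simp only [a.periodic x, b.periodic x], fun _ => Set.mem_univ _⟩
  have hz : ∫ x in (0 : ℝ)..1, ∑ i, φ x i * φ x i = 0 := by
    have h1 := sub_eq_zero.mpr (h φ)
    rw [pair, pair, ← intervalIntegral.integral_sub (pair_intervalIntegrable a φ)
      (pair_intervalIntegrable b φ)] at h1
    refine Eq.trans ?_ h1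
    refine intervalIntegral.integral_congr fun x _ => ?_
    simp only [← Finset.sum_sub_distrib, ← sub_mul]
    rfl
  have hnn : ∀ x, 0 ≤ ∑ i, φ x i * φ x i := fun x =>
    Finset.sum_nonneg fun i _ => mul_self_nonneg _
  have h01 : ∀ x ∈ Set.Icc (0 : ℝ) 1, ∑ i, φ x i * φ x i = 0 := by
    intro x hx
    by_contra hne
    refine (intervalIntegral.integral_pos one_pos ?_ (fun y _ => hnn y)
      ⟨x, hx, lt_of_le_of_ne (hnn x) (Ne.symm hne)⟩).ne' hz
    exact (continuous_finsetSum _ fun i _ =>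
      (φ.continuous_coord i).mul (φ.continuous_coord i)).continuousOn
  refine Field.ext' fun x => ?_
  obtain ⟨y, hy, hxy⟩ := φ.periodic.exists_mem_Ico₀ one_pos x
  have h0 : φ x = 0 := by
    rw [hxy]
    funext i
    have := (Finset.sum_eq_zero_iff_of_nonneg fun i _ => mul_self_nonneg (φ y i)).mp
      (h01 y ⟨hy.1, hy.2.le⟩) i (Finset.mem_univ i)
    exact mul_self_eq_zero.mp this
  exact sub_eq_zero.mp h0

section Families

variable {E : Type*} [NormedAddCommGroup E] [NormedSpace ℝ E]

/-- Smooth families of fields parametrized by an open set of a normed space. -/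
def IsSmoothFamilyOn (O : Set E) (v : E → Field U) : Prop :=
  ContDiffOn ℝ ∞ (fun q : E × ℝ => v q.1 q.2) (O ×ˢ Set.univ)

/-- The `i`-th component of a family of fields. -/
def coord (v : E → Field U) (i : Fin n) (q : E × ℝ) : ℝ := v q.1 q.2 i

variable {O : Set E} {v : E → Field U}

theorem IsSmoothFamilyOn.coord (hv : IsSmoothFamilyOn O v) (i : Fin n) :
    ContDiffOn ℝ ∞ (coord v i) (O ×ˢ Set.univ) :=
  contDiffOn_pi.mp hv i

theorem isSmoothFamilyOn_const (u : Field U) : IsSmoothFamilyOn O fun _ => u :=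
  (u.smooth.comp contDiff_snd).contDiffOn

theorem IsSmoothFamilyOn.comp {E' : Type*} [NormedAddCommGroup E'] [NormedSpace ℝ E']
    (hv : IsSmoothFamilyOn O v) {O' : Set E'} {γ : E' → E} (hγ : ContDiff ℝ ∞ γ)
    (h : Set.MapsTo γ O' O) : IsSmoothFamilyOn O' fun ε => v (γ ε) :=
  ContDiffOn.comp (f := fun q : E' × ℝ => (γ q.1, q.2)) hv
    ((hγ.comp contDiff_fst).prodMk contDiff_snd).contDiffOn fun _ hq => ⟨h hq.1, hq.2⟩

variable {F : Field U → ℝ} {δ : Field U → Covector n}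

section General

variable [FiniteDimensional ℝ E]

/-- The defining properties of a variational derivative refer to parameters in `ℝᵐ`. Linear
coordinates carry them over to any finite-dimensional space, in particular to `E × ℝ`, where a
perturbation parameter is added. -/
theorem exists_continuousLinearEquiv_pi (E : Type*) [NormedAddCommGroup E] [NormedSpace ℝ E]
    [FiniteDimensional ℝ E] : ∃ m : ℕ, Nonempty (E ≃L[ℝ] (Fin m → ℝ)) :=
  ⟨_, ⟨(Module.finBasis ℝ E).equivFunL⟩⟩

theorem IsVariationalDerivative.contDiffOn (hF : IsVariationalDerivative F δ) (hO : IsOpen O)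
    (hv : IsSmoothFamilyOn O v) : ContDiffOn ℝ ∞ (fun ε => F (v ε)) O := by
  obtain ⟨m, ⟨L⟩⟩ := exists_continuousLinearEquiv_pi E
  have h := hF.smooth m (L.symm ⁻¹' O) (fun y => v (L.symm y)) (hO.preimage L.symm.continuous)
    (hv.comp L.symm.contDiff fun y hy => hy)
  have h2 := h.comp (f := L) (s := O) L.contDiff.contDiffOn fun ε hε => by simpa using hε
  simpa [Function.comp_def] using h2

theorem IsVariationalDerivative.grad_family (hF : IsVariationalDerivative F δ) (hO : IsOpen O)
    (hv : IsSmoothFamilyOn O v) : IsSmoothFamilyOn O fun ε => δ (v ε) := by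
  obtain ⟨m, ⟨L⟩⟩ := exists_continuousLinearEquiv_pi E
  have h := hF.smooth_grad m (L.symm ⁻¹' O) (fun y => v (L.symm y))
    (hO.preimage L.symm.continuous) (hv.comp L.symm.contDiff fun y hy => hy)
  have h2 := IsSmoothFamilyOn.comp (v := fun y => δ (v (L.symm y))) (O := L.symm ⁻¹' O)
    (γ := L) (O' := O) h L.contDiff fun ε hε => by simpa using hε
  simpa using h2

theorem IsVariationalDerivative.fderiv_family (hF : IsVariationalDerivative F δ) (hO : IsOpen O)
    (hv : IsSmoothFamilyOn O v) {ε : E} (hε : ε ∈ O) (e : E) :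
    fderiv ℝ (fun ε' => F (v ε')) ε e =
      ∫ x in (0 : ℝ)..1, ∑ i, coord (fun ε' => δ (v ε')) i (ε, x) * dd (e, 0) (coord v i) (ε, x) := by
  obtain ⟨m, ⟨L⟩⟩ := exists_continuousLinearEquiv_pi E
  have hO' : IsOpen (L.symm ⁻¹' O) := hO.preimage L.symm.continuous
  have hv' : IsSmoothFamilyOn (L.symm ⁻¹' O) (fun y => v (L.symm y)) :=
    hv.comp L.symm.contDiff fun y hy => hy
  have hLε : L ε ∈ L.symm ⁻¹' O := by simpa using hε
  have h := hF.fderiv_eq m _ (fun y => v (L.symm y)) hO' hv' (L ε) hLε (L e)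
  have chain : ∀ G : E → ℝ, DifferentiableAt ℝ G ε →
      fderiv ℝ (fun y => G (L.symm y)) (L ε) (L e) = fderiv ℝ G ε e := by
    intro G hG
    have hG' : DifferentiableAt ℝ G (L.symm (L ε)) := by simpa using hG
    rw [fderiv_fun_comp (L ε) hG' L.symm.differentiableAt, L.symm.fderiv]
    simp
  rw [chain (fun ε' => F (v ε')) (differentiableAt_of_smooth hO (hF.contDiffOn hO hv) hε)] at h
  rw [h]
  refine intervalIntegral.integral_congr fun x _ => Finset.sum_congr rfl fun i _ => ?_
  rw [chain (fun ε' => v ε' x i)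
    (hasFDerivAt_slice hO (hv.coord i) hε x).differentiableAt]
  rw [← fderiv_slice hO (hv.coord i) hε x e]
  simp [coord]

/-- The second variation of a functional along a family of fields is symmetric. -/
theorem IsVariationalDerivative.symm_family (hF : IsVariationalDerivative F δ) (hO : IsOpen O)
    (hv : IsSmoothFamilyOn O v) {ε : E} (hε : ε ∈ O) (e₁ e₂ : E) :
    ∫ x in (0 : ℝ)..1, ∑ i, dd (e₂, 0) (coord (fun ε' => δ (v ε')) i) (ε, x) *
        dd (e₁, 0) (coord v i) (ε, x) =
      ∫ x in (0 : ℝ)..1, ∑ i, dd (e₁, 0) (coord (fun ε' => δ (v ε')) i) (ε, x) *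
        dd (e₂, 0) (coord v i) (ε, x) := by
  have hΩ : IsOpen (O ×ˢ (Set.univ : Set ℝ)) := hO.prod isOpen_univ
  have hδ := hF.grad_family hO hv
  have hdv : ∀ (e : E) i, ContDiffOn ℝ ∞ (dd (e, (0 : ℝ)) (coord v i)) (O ×ˢ Set.univ) :=
    fun e i => dd_contDiffOn hΩ (hv.coord i) _
  have hm : ∀ (e : E) i, ContDiffOn ℝ ∞ (fun q => coord (fun ε' => δ (v ε')) i q *
      dd (e, (0 : ℝ)) (coord v i) q) (O ×ˢ Set.univ) := fun e i => (hδ.coord i).mul (hdv e i)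
  -- Differentiate the first variation formula once more. The second term contains the mixed
  -- derivative of `v`, is symmetric in `a` and `b`, and so drops out of the comparison.
  have key : ∀ a b : E, dd b (dd a fun ε' => F (v ε')) ε =
      (∫ x in (0 : ℝ)..1, ∑ i, dd (b, 0) (coord (fun ε' => δ (v ε')) i) (ε, x) *
        dd (a, 0) (coord v i) (ε, x)) +
      ∫ x in (0 : ℝ)..1, ∑ i, coord (fun ε' => δ (v ε')) i (ε, x) *
        dd (b, 0) (dd (a, 0) (coord v i)) (ε, x) := by
    intro a b
    rw [dd_congr (f := dd a fun ε' => F (v ε')) hO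
      (fun ε' hε' => hF.fderiv_family hO hv hε' a) hε b]
    have hs : ContDiffOn ℝ ∞ (fun q => ∑ i, coord (fun ε' => δ (v ε')) i q *
      dd (a, (0 : ℝ)) (coord v i) q) (O ×ˢ Set.univ) := ContDiffOn.sum fun i _ => hm a i
    have h1 : dd b (fun ε => ∫ x in (0 : ℝ)..1, ∑ i, coord (fun ε' => δ (v ε')) i (ε, x) *
        dd (a, 0) (coord v i) (ε, x)) ε = _ := fderiv_integral hO hs hε b
    rw [h1, ← intervalIntegral.integral_add]
    · refine intervalIntegral.integral_congr fun x _ => ?_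
      have hq : (ε, x) ∈ O ×ˢ (Set.univ : Set ℝ) := ⟨hε, Set.mem_univ x⟩
      rw [dd_sum hΩ (hm a) hq, ← Finset.sum_add_distrib]
      exact Finset.sum_congr rfl fun i _ => dd_mul hΩ (hδ.coord i) (hdv a i) hq _
    · exact (contDiff_slice (ContDiffOn.sum fun i _ =>
        (dd_contDiffOn hΩ (hδ.coord i) (b, 0)).mul (hdv a i)) hε).continuous.intervalIntegrable _ _
    · exact (contDiff_slice (ContDiffOn.sum fun i _ =>
        (hδ.coord i).mul (dd_contDiffOn hΩ (hdv a i) (b, 0))) hε).continuous.intervalIntegrable _ _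
  have hsymm := dd_comm hO (hF.contDiffOn hO hv) hε e₂ e₁
  rw [key, key] at hsymm
  have hlast : ∀ x, ∀ i, dd (e₂, 0) (dd (e₁, 0) (coord v i)) (ε, x) =
      dd (e₁, 0) (dd (e₂, 0) (coord v i)) (ε, x) := fun x i =>
    dd_comm hΩ (hv.coord i) ⟨hε, Set.mem_univ x⟩ _ _
  simp only [hlast] at hsymm
  exact add_right_cancel hsymm

end General

end Families

/-! #### Linear perturbations of fields -/

open Classical in
/-- The field `u + τ φ`, as long as it takes its values in `U`. -/
noncomputable def perturb (u : Field U) (φ : Covector n) (τ : ℝ) : Field U :=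
  if h : ∀ x, u x + τ • φ x ∈ U then
    ⟨fun x => u x + τ • φ x, u.smooth.add (φ.smooth.const_smul τ),
      fun x => by simp only [u.periodic x, φ.periodic x], h⟩
  -- An arbitrary value: only `τ` near `0` matters, where the condition holds for open `U`.
  else u

theorem perturb_apply {u : Field U} {φ : Covector n} {τ : ℝ} (h : ∀ x, u x + τ • φ x ∈ U) (x : ℝ) :
    perturb u φ τ x = u x + τ • φ x := by
  simp only [perturb, dif_pos h]

theorem perturb_zero (u : Field U) (φ : Covector n) : perturb u φ 0 = u :=
  Field.ext' fun x => by
    rw [perturb_apply (fun x => by simpa using u.mem x)]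
    simp

section Perturbation

variable {E : Type*} {O : Set E} {v : E → Field U}
  {φ : E → Covector n}

/-- The parameters `(ε, τ)` for which `v_ε + τ φ_ε` takes its values in `U`. -/
def perturbDomain (O : Set E) (v : E → Field U) (φ : E → Covector n) : Set (E × ℝ) :=
  {p | p.1 ∈ O ∧ ∀ x, v p.1 x + p.2 • φ p.1 x ∈ U}

theorem zero_mem_perturbDomain {ε : E} (hε : ε ∈ O) : (ε, (0 : ℝ)) ∈ perturbDomain O v φ :=
  ⟨hε, fun x => by simpa using (v ε).mem x⟩

variable [NormedAddCommGroup E] [NormedSpace ℝ E]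

theorem smooth_perturbation (hv : IsSmoothFamilyOn O v) (hφ : IsSmoothFamilyOn O φ) :
    ContDiffOn ℝ ∞ (fun q : (E × ℝ) × ℝ => v q.1.1 q.2 + q.1.2 • φ q.1.1 q.2)
      ((O ×ˢ Set.univ) ×ˢ Set.univ) := by
  have h : Set.MapsTo (fun q : (E × ℝ) × ℝ => (q.1.1, q.2)) ((O ×ˢ Set.univ) ×ˢ Set.univ)
      (O ×ˢ Set.univ) := fun q hq => ⟨hq.1.1, Set.mem_univ _⟩
  refine ContDiffOn.add (ContDiffOn.comp hv (by fun_prop) h) (ContDiffOn.fun_smul ?_ ?_)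
  · exact (contDiff_snd.comp contDiff_fst).contDiffOn
  exact ContDiffOn.comp hφ (by fun_prop) h

/-- By periodicity the condition only concerns `x` in the compact interval `[0, 1]`, so the tube
lemma applies. -/
theorem isOpen_perturbDomain (hU : IsOpen U) (hO : IsOpen O) (hv : IsSmoothFamilyOn O v)
    (hφ : IsSmoothFamilyOn O φ) : IsOpen (perturbDomain O v φ) := by
  have hper : ∀ p : E × ℝ, (∀ x ∈ Set.Icc (0 : ℝ) 1, v p.1 x + p.2 • φ p.1 x ∈ U) →
      ∀ x, v p.1 x + p.2 • φ p.1 x ∈ U := by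
    intro p hp x
    have hper : Function.Periodic (fun x => v p.1 x + p.2 • φ p.1 x) 1 := fun x => by
      simp only [(v p.1).periodic x, (φ p.1).periodic x]
    obtain ⟨y, hy, hxy⟩ := hper.exists_mem_Ico₀ one_pos x
    have := hp y ⟨hy.1, hy.2.le⟩
    rw [← hxy] at this
    exact this
  rw [isOpen_iff_mem_nhds]
  rintro p ⟨hp1, hp2⟩
  have hΩ : IsOpen ((O ×ˢ (Set.univ : Set ℝ)) ×ˢ (Set.univ : Set ℝ)) :=
    (hO.prod isOpen_univ).prod isOpen_univ
  have hc := (smooth_perturbation hv hφ).continuousOn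
  have h1 := (isCompact_Icc (a := (0 : ℝ)) (b := 1)).eventually_forall_of_forall_eventually
    (x₀ := p) (P := fun p x => v p.1 x + p.2 • φ p.1 x ∈ U) fun x _ =>
      (hc.continuousAt (hΩ.mem_nhds ⟨⟨hp1, Set.mem_univ _⟩, Set.mem_univ _⟩)).eventually_mem
        (hU.mem_nhds (hp2 x))
  have h2 : ∀ᶠ p' : E × ℝ in 𝓝 p, p'.1 ∈ O :=
    continuous_fst.continuousAt.eventually_mem (hO.mem_nhds hp1)
  filter_upwards [h1, h2] with p' hp' hp'' using ⟨hp'', hper p' hp'⟩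

theorem IsSmoothFamilyOn.perturb (hv : IsSmoothFamilyOn O v) (hφ : IsSmoothFamilyOn O φ) :
    IsSmoothFamilyOn (perturbDomain O v φ) fun p : E × ℝ => perturb (v p.1) (φ p.1) p.2 :=
  ((smooth_perturbation hv hφ).mono
    fun _ hq => ⟨⟨hq.1.1, Set.mem_univ _⟩, Set.mem_univ _⟩).congr
    fun q hq => perturb_apply hq.1.2 q.2

theorem dd_eq_deriv {f : E → ℝ} {q : E} (hf : DifferentiableAt ℝ f q) (z : E) :
    dd z f q = deriv (fun t : ℝ => f (q + t • z)) 0 :=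
  (hf.lineDeriv_eq_fderiv).symm

variable {F : Field U → ℝ} {δ : Field U → Covector n}

/-- The components of the derivative of the gradient `δ` at `u` in the direction `φ`. -/
noncomputable def gradDeriv (δ : Field U → Covector n) (u : Field U) (φ : Covector n) (i : Fin n)
    (x : ℝ) : ℝ := deriv (fun τ : ℝ => δ (perturb u φ τ) x i) 0

theorem gradDeriv_eq_dd [FiniteDimensional ℝ E] (hU : IsOpen U) (hF : IsVariationalDerivative F δ)
    (hO : IsOpen O) (hv : IsSmoothFamilyOn O v) (hφ : IsSmoothFamilyOn O φ) {ε : E} (hε : ε ∈ O)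
    (i : Fin n) (x : ℝ) :
    gradDeriv δ (v ε) (φ ε) i x =
      dd (((0 : E), (1 : ℝ)), (0 : ℝ))
        (coord (fun p : E × ℝ => δ (perturb (v p.1) (φ p.1) p.2)) i) ((ε, 0), x) := by
  have hD := isOpen_perturbDomain hU hO hv hφ
  have hs := (hF.grad_family hD (hv.perturb hφ)).coord i
  rw [dd_eq_deriv (differentiableAt_of_smooth (hD.prod isOpen_univ) hs
    ⟨zero_mem_perturbDomain hε, Set.mem_univ x⟩)]
  simp [gradDeriv, coord]

/-- The derivative in `τ` of a smooth family on the open perturbation domain is smooth, and so is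
its restriction to `τ = 0`. -/
theorem contDiffOn_gradDeriv [FiniteDimensional ℝ E] (hU : IsOpen U)
    (hF : IsVariationalDerivative F δ) (hO : IsOpen O) (hv : IsSmoothFamilyOn O v)
    (hφ : IsSmoothFamilyOn O φ) (i : Fin n) :
    ContDiffOn ℝ ∞ (fun q : E × ℝ => gradDeriv δ (v q.1) (φ q.1) i q.2) (O ×ˢ Set.univ) := by
  have hD := isOpen_perturbDomain hU hO hv hφ
  have hs := (hF.grad_family hD (hv.perturb hφ)).coord i
  have h := (dd_contDiffOn (hD.prod isOpen_univ) hs (((0 : E), (1 : ℝ)), (0 : ℝ))).comp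
    (f := fun q : E × ℝ => ((q.1, (0 : ℝ)), q.2)) (s := O ×ˢ Set.univ) (by fun_prop)
    fun q hq => ⟨zero_mem_perturbDomain hq.1, Set.mem_univ _⟩
  exact h.congr fun q hq => gradDeriv_eq_dd hU hF hO hv hφ hq.1 i q.2

/-- The derivative of the gradient `δ` at `u` in the direction `φ`. -/
noncomputable def secondVar (hU : IsOpen U) (hF : IsVariationalDerivative F δ) (u : Field U)
    (φ : Covector n) : Covector n where
  toFun x i := gradDeriv δ u φ i x
  smooth := contDiff_pi.mpr fun i => contDiff_slice (q := (0 : ℝ)) (contDiffOn_gradDeriv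
    (O := Set.univ) (v := fun _ : ℝ => u) (φ := fun _ => φ) hU hF isOpen_univ
    (isSmoothFamilyOn_const u) (isSmoothFamilyOn_const φ) i) (Set.mem_univ _)
  periodic x := by simp only [gradDeriv, (δ _).periodic x]
  mem _ := Set.mem_univ _

theorem IsSmoothFamilyOn.secondVar [FiniteDimensional ℝ E] (hU : IsOpen U)
    (hF : IsVariationalDerivative F δ) (hO : IsOpen O) (hv : IsSmoothFamilyOn O v)
    (hφ : IsSmoothFamilyOn O φ) :
    IsSmoothFamilyOn O fun ε => secondVar hU hF (v ε) (φ ε) :=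
  contDiffOn_pi.mpr fun i => contDiffOn_gradDeriv hU hF hO hv hφ i

theorem dd_coord_perturb (hU : IsOpen U) (hO : IsOpen O) (hv : IsSmoothFamilyOn O v)
    (hφ : IsSmoothFamilyOn O φ) {ε : E} (hε : ε ∈ O) (i : Fin n) (x : ℝ) :
    dd (((0 : E), (1 : ℝ)), (0 : ℝ))
      (coord (fun p : E × ℝ => InfoFrobenius.perturb (v p.1) (φ p.1) p.2) i) ((ε, 0), x) =
      φ ε x i := by
  have hD := isOpen_perturbDomain hU hO hv hφ
  have hd := (hv.perturb hφ).coord i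
  rw [dd_eq_deriv (differentiableAt_of_smooth (hD.prod isOpen_univ) hd
    ⟨zero_mem_perturbDomain hε, Set.mem_univ x⟩)]
  have hnear : ∀ᶠ t : ℝ in 𝓝 0, (ε, t) ∈ perturbDomain O v φ :=
    (Continuous.prodMk_right ε).continuousAt.eventually_mem
      (hD.mem_nhds (zero_mem_perturbDomain hε))
  have heq : (fun t : ℝ => coord
      (fun p : E × ℝ => InfoFrobenius.perturb (v p.1) (φ p.1) p.2) i
      (((ε, (0 : ℝ)), x) + t • (((0 : E), (1 : ℝ)), (0 : ℝ)))) =ᶠ[𝓝 0]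
      fun t => v ε x i + t * φ ε x i := by
    filter_upwards [hnear] with t ht
    simp [coord, perturb_apply ht.2]
  rw [heq.deriv_eq]
  simp

/-- The derivative of the gradient in a family of fields is adjoint to the second variation. -/
theorem pair_secondVar_family [FiniteDimensional ℝ E] (hU : IsOpen U)
    (hF : IsVariationalDerivative F δ) (hO : IsOpen O) (hv : IsSmoothFamilyOn O v)
    {ε : E} (hε : ε ∈ O) (e : E) (ψ : Covector n) :
    ∫ x in (0 : ℝ)..1, ∑ i, dd (e, 0) (coord (fun ε' => δ (v ε')) i) (ε, x) * ψ x i =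
      ∫ x in (0 : ℝ)..1, ∑ i, secondVar hU hF (v ε) ψ x i * dd (e, 0) (coord v i) (ε, x) := by
  have hψ : IsSmoothFamilyOn O fun _ : E => ψ := isSmoothFamilyOn_const ψ
  have hD := isOpen_perturbDomain hU hO hv hψ
  have hV := hv.perturb hψ
  have hz : (ε, (0 : ℝ)) ∈ perturbDomain O v fun _ => ψ := zero_mem_perturbDomain hε
  have hΩ := hO.prod (isOpen_univ (X := ℝ))
  have hΩ' := hD.prod (isOpen_univ (X := ℝ))
  -- Symmetry of the second variation for the family `v_ε + τ ψ` at `τ = 0`, in the directions `∂_τ`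
  -- and `e`. The `τ`-derivatives yield `ψ` and `secondVar`; the `e`-derivatives see only `v`, as
  -- shown next.
  have h := hF.symm_family hD hV hz ((0 : E), (1 : ℝ)) (e, 0)
  simp only [dd_coord_perturb hU hO hv hψ hε, ← gradDeriv_eq_dd hU hF hO hv hψ hε] at h
  have h1 : ∀ i x, dd ((e, (0 : ℝ)), (0 : ℝ)) (coord (fun p : E × ℝ =>
      δ (InfoFrobenius.perturb (v p.1) ψ p.2)) i) ((ε, 0), x) =
      dd (e, 0) (coord (fun ε' => δ (v ε')) i) (ε, x) := by
    intro i x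
    rw [dd_eq_deriv (differentiableAt_of_smooth hΩ' ((hF.grad_family hD hV).coord i)
        ⟨hz, Set.mem_univ x⟩),
      dd_eq_deriv (differentiableAt_of_smooth hΩ ((hF.grad_family hO hv).coord i)
        ⟨hε, Set.mem_univ x⟩)]
    simp [coord, perturb_zero]
  have h2 : ∀ i x, dd ((e, (0 : ℝ)), (0 : ℝ)) (coord (fun p : E × ℝ =>
      InfoFrobenius.perturb (v p.1) ψ p.2) i) ((ε, 0), x) = dd (e, 0) (coord v i) (ε, x) := by
    intro i x
    rw [dd_eq_deriv (differentiableAt_of_smooth hΩ' (hV.coord i) ⟨hz, Set.mem_univ x⟩),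
      dd_eq_deriv (differentiableAt_of_smooth hΩ (hv.coord i) ⟨hε, Set.mem_univ x⟩)]
    simp [coord, perturb_zero]
  simp only [h1, h2] at h
  exact h

end Perturbation

variable {F : Field U → ℝ} {δ : Field U → Covector n}

/-- A single field is treated as a constant family over a dummy real parameter, evaluated at `0`, so
that the results on perturbed families apply. -/
theorem exists_perturb_family (hU : IsOpen U) (u : Field U) (φ : Covector n) :
    ∃ O : Set ℝ, IsOpen O ∧ (0 : ℝ) ∈ O ∧ IsSmoothFamilyOn O (perturb u φ) ∧
      ∀ i x, dd ((1 : ℝ), (0 : ℝ)) (coord (perturb u φ) i) (0, x) = φ x i := by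
  have hu : IsSmoothFamilyOn (Set.univ : Set ℝ) fun _ : ℝ => u := isSmoothFamilyOn_const u
  have hφ : IsSmoothFamilyOn (Set.univ : Set ℝ) fun _ : ℝ => φ := isSmoothFamilyOn_const φ
  have hD := isOpen_perturbDomain hU isOpen_univ hu hφ
  have hO : IsOpen {τ : ℝ | ((0 : ℝ), τ) ∈ perturbDomain Set.univ (fun _ : ℝ => u) fun _ => φ} :=
    hD.preimage (Continuous.prodMk_right (0 : ℝ))
  have h0 : (0 : ℝ) ∈ {τ : ℝ | ((0 : ℝ), τ) ∈ perturbDomain Set.univ (fun _ : ℝ => u) fun _ => φ} :=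
    zero_mem_perturbDomain (v := fun _ : ℝ => u) (φ := fun _ => φ) (ε := (0 : ℝ)) (Set.mem_univ _)
  have hs : IsSmoothFamilyOn
      {τ : ℝ | ((0 : ℝ), τ) ∈ perturbDomain Set.univ (fun _ : ℝ => u) fun _ => φ} (perturb u φ) :=
    (hu.perturb hφ).comp (γ := fun τ : ℝ => ((0 : ℝ), τ)) (by fun_prop) fun τ hτ => hτ
  refine ⟨_, hO, h0, hs, fun i x => ?_⟩
  rw [← dd_coord_perturb hU isOpen_univ hu hφ (Set.mem_univ (0 : ℝ)) i x,
    dd_eq_deriv (differentiableAt_of_smooth (hO.prod isOpen_univ) (hs.coord i)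
      ⟨h0, Set.mem_univ x⟩),
    dd_eq_deriv (differentiableAt_of_smooth (hD.prod isOpen_univ) ((hu.perturb hφ).coord i)
      ⟨zero_mem_perturbDomain (Set.mem_univ _), Set.mem_univ x⟩)]
  simp [coord]

/-- The adjointness along families, applied to `u + τ φ`, whose velocity at `τ = 0` is `φ`. This
symmetry removes all second variations from the Jacobi identity. -/
theorem pair_secondVar_comm (hU : IsOpen U) (hF : IsVariationalDerivative F δ) (u : Field U)
    (φ ψ : Covector n) : pair (secondVar hU hF u φ) ψ = pair (secondVar hU hF u ψ) φ := by
  obtain ⟨O, hO, h0, hs, hd⟩ := exists_perturb_family hU u φ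
  have h := pair_secondVar_family hU hF hO hs h0 1 ψ
  simp only [hd, perturb_zero] at h
  refine Eq.trans (intervalIntegral.integral_congr fun x _ => Finset.sum_congr rfl fun i _ => ?_) h
  rw [dd_eq_deriv (differentiableAt_of_smooth (hO.prod isOpen_univ)
    ((hF.grad_family hO hs).coord i) ⟨h0, Set.mem_univ x⟩)]
  simp [coord, secondVar, gradDeriv]

theorem IsVariationalDerivative.hasDerivAt (hU : IsOpen U) (hF : IsVariationalDerivative F δ)
    (u : Field U) (φ : Covector n) :
    HasDerivAt (fun τ => F (perturb u φ τ)) (pair (δ u) φ) 0 := by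
  obtain ⟨O, hO, h0, hs, hd⟩ := exists_perturb_family hU u φ
  have h := hF.fderiv_family hO hs h0 1
  simp only [hd, coord, perturb_zero] at h
  have h1 := (differentiableAt_of_smooth hO (hF.contDiffOn hO hs) h0).hasFDerivAt.hasDerivAt
  rwa [h] at h1

/-- The gradient of a smooth functional. -/
noncomputable def grad (F : smoothFunctionals U) : Field U → Covector n := Classical.choose F.2

theorem grad_spec (F : smoothFunctionals U) :
    IsVariationalDerivative (F : Field U → ℝ) (grad F) := Classical.choose_spec F.2

/-- Directional derivatives at `τ = 0` determine the gradient because the pairing is nondegenerate.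
The rules for sums, multiples and products of gradients follow from it. -/
theorem grad_eq_of_hasDerivAt (hU : IsOpen U) (F : smoothFunctionals U) (u : Field U)
    (a : Covector n)
    (h : ∀ φ, HasDerivAt (fun τ => (F : Field U → ℝ) (perturb u φ τ)) (pair a φ) 0) :
    grad F u = a :=
  pair_ext fun φ => ((grad_spec F).hasDerivAt hU u φ).unique (h φ)

theorem IsVariationalDerivative.eq_grad (hU : IsOpen U) (F : smoothFunctionals U)
    (hF : IsVariationalDerivative (F : Field U → ℝ) δ) : δ = grad F :=
  funext fun u => (grad_eq_of_hasDerivAt hU F u _ fun φ => hF.hasDerivAt hU u φ).symm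

/-- The linear combination `r a + s b` of covector fields. -/
def lincomb (r s : ℝ) (a b : Covector n) : Covector n :=
  ⟨fun x => r • a x + s • b x, (a.smooth.const_smul r).add (b.smooth.const_smul s),
    fun x => by simp only [a.periodic x, b.periodic x], fun _ => Set.mem_univ _⟩

theorem pair_lincomb (r s : ℝ) (a b φ : Covector n) :
    pair (lincomb r s a b) φ = r * pair a φ + s * pair b φ := by
  simp only [pair]
  rw [← intervalIntegral.integral_const_mul, ← intervalIntegral.integral_const_mul,
    ← intervalIntegral.integral_add ((pair_intervalIntegrable _ _).const_mul _)
      ((pair_intervalIntegrable _ _).const_mul _)]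
  refine intervalIntegral.integral_congr fun x _ => ?_
  simp only [lincomb, Pi.add_apply, Pi.smul_apply, smul_eq_mul, Finset.mul_sum,
    ← Finset.sum_add_distrib]
  exact Finset.sum_congr rfl fun i _ => by ring

theorem grad_add (hU : IsOpen U) (F G : smoothFunctionals U) (u : Field U) :
    grad (F + G) u = lincomb 1 1 (grad F u) (grad G u) := by
  refine grad_eq_of_hasDerivAt hU _ u _ fun φ => ?_
  rw [pair_lincomb, one_mul, one_mul]
  exact ((grad_spec F).hasDerivAt hU u φ).add ((grad_spec G).hasDerivAt hU u φ)

theorem grad_smul (hU : IsOpen U) (r : ℝ) (F : smoothFunctionals U) (u : Field U) :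
    grad (r • F) u = lincomb r 0 (grad F u) (grad F u) := by
  refine grad_eq_of_hasDerivAt hU _ u _ fun φ => ?_
  rw [pair_lincomb, zero_mul, add_zero]
  exact ((grad_spec F).hasDerivAt hU u φ).const_mul r

theorem grad_mul (hU : IsOpen U) (F G : smoothFunctionals U) (u : Field U) :
    grad (F * G) u =
      lincomb ((G : Field U → ℝ) u) ((F : Field U → ℝ) u) (grad F u) (grad G u) := by
  refine grad_eq_of_hasDerivAt hU _ u _ fun φ => ?_
  rw [pair_lincomb]
  have h := ((grad_spec F).hasDerivAt hU u φ).mul ((grad_spec G).hasDerivAt hU u φ)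
  simp only [perturb_zero] at h
  rw [mul_comm _ (pair (grad F u) φ)]
  exact h

end Variations

/-! ### The pointwise algebra behind the Jacobi identity. -/

section TrilinearForms

variable {n : ℕ}

/-- The trilinear form with coefficients `S`. -/
def trilinear (S : Fin n → Fin n → Fin n → ℝ) (x y z : Fin n → ℝ) : ℝ :=
  ∑ i, ∑ j, ∑ m, S i j m * (x i * y j * z m)

theorem trilinear_cyclic {S : Fin n → Fin n → Fin n → ℝ} (hS : ∀ i j m, S i j m = S j m i)
    (x y z : Fin n → ℝ) : trilinear S x y z = trilinear S y z x := by
  unfold trilinear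
  rw [Finset.sum_comm]
  refine Finset.sum_congr rfl fun j _ => ?_
  rw [Finset.sum_comm]
  refine Finset.sum_congr rfl fun m _ => Finset.sum_congr rfl fun i _ => ?_
  rw [hS i j m]
  ring

theorem sum_mul_eq_trilinear (b : Fin n → Fin n → Fin n → ℝ) (K : Fin n → Fin n → ℝ)
    (x y z : Fin n → ℝ) :
    ∑ l, (∑ i, ∑ j, b i j l * (x i * y j)) * ∑ m, K l m * z m =
      trilinear (fun i j m => ∑ l, b i j l * K l m) x y z := by
  unfold trilinear
  simp only [Finset.sum_mul]
  simp only [Finset.mul_sum]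
  rw [Finset.sum_comm]
  refine Finset.sum_congr rfl fun i _ => ?_
  rw [Finset.sum_comm]
  refine Finset.sum_congr rfl fun j _ => ?_
  rw [Finset.sum_comm]
  refine Finset.sum_congr rfl fun m _ => Finset.sum_congr rfl fun l _ => ?_
  ring

/-- Here `a', c', e', w` stand for the `x`-derivatives of `a, c, e, u`, treated as independent
vectors. The sum splits into terms in `Q = b h` with two primed arguments and terms in `R = b b w`
with one; cyclic invariance of `Q` and `R` makes each kind cancel separately. -/
theorem cyclic_sum_eq_zero {b : Fin n → Fin n → Fin n → ℝ} {h : Fin n → Fin n → ℝ}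
    (hb : ∀ i j k, b i j k = b j i k)
    (hbh : ∀ i j m, ∑ l, b i j l * h l m = ∑ l, b i m l * h l j)
    (hbb : ∀ i j m k, ∑ l, b i j l * b l m k = ∑ l, b i m l * b l j k)
    (a c e a' c' e' w : Fin n → ℝ) :
    (∑ l, (∑ i, ∑ j, b i j l * (a i * c' j - a' i * c j)) *
        ∑ m, (h l m * e' m + ∑ k, b l m k * w k * e m)) +
      (∑ l, (∑ i, ∑ j, b i j l * (c i * e' j - c' i * e j)) *
        ∑ m, (h l m * a' m + ∑ k, b l m k * w k * a m)) +
      (∑ l, (∑ i, ∑ j, b i j l * (e i * a' j - e' i * a j)) *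
        ∑ m, (h l m * c' m + ∑ k, b l m k * w k * c m)) = 0 := by
  have hQ : ∀ i j m, ∑ l, b i j l * h l m = ∑ l, b j m l * h l i := by
    intro i j m
    rw [← hbh j i m]
    simp only [hb i j]
  have hR : ∀ i j m, ∑ l, b i j l * (∑ k, b l m k * w k) =
      ∑ l, b j m l * (∑ k, b l i k * w k) := by
    intro i j m
    simp only [Finset.mul_sum, ← mul_assoc]
    rw [Finset.sum_comm]
    conv_rhs => rw [Finset.sum_comm]
    simp only [← Finset.sum_mul]
    refine Finset.sum_congr rfl fun k _ => ?_
    rw [← hbb j i m k]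
    simp only [hb i j]
  have key : ∀ x y z x' y' z' : Fin n → ℝ,
      ∑ l, (∑ i, ∑ j, b i j l * (x i * y' j - x' i * y j)) *
        ∑ m, (h l m * z' m + ∑ k, b l m k * w k * z m) =
      trilinear (fun i j m => ∑ l, b i j l * h l m) x y' z' -
        trilinear (fun i j m => ∑ l, b i j l * h l m) x' y z' +
        (trilinear (fun i j m => ∑ l, b i j l * (∑ k, b l m k * w k)) x y' z -
        trilinear (fun i j m => ∑ l, b i j l * (∑ k, b l m k * w k)) x' y z) := by
    intro x y z x' y' z'
    simp only [← sum_mul_eq_trilinear, ← Finset.sum_sub_distrib, ← Finset.sum_add_distrib]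
    refine Finset.sum_congr rfl fun l _ => ?_
    simp only [mul_sub, Finset.sum_sub_distrib, Finset.sum_add_distrib, Finset.sum_mul]
    simp only [← Finset.sum_mul]
    ring
  rw [key, key, key]
  -- Six terms in `Q` and six in `R`, each cancelled by a rotated copy with opposite sign.
  linarith [trilinear_cyclic hQ e' a c', trilinear_cyclic hQ a' c e',
    trilinear_cyclic hQ c' e a', trilinear_cyclic hR a c' e, trilinear_cyclic hR e a' c,
    trilinear_cyclic hR c e' a]

end TrilinearForms

/-! ### The bracket of hydrodynamic type, its gradient and its Poisson property. -/

section Bracket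

variable {n : ℕ} {U : Set (Fin n → ℝ)} {h : (Fin n → ℝ) → Matrix (Fin n) (Fin n) ℝ}
  {b : (Fin n → ℝ) → Fin n → Fin n → Fin n → ℝ}

/-- Symmetric tensors `hⁱʲ` and `bⁱʲ_k = ∂_k hⁱʲ / 2` such that `bⁱʲ_l hˡᵐ` and `bⁱʲ_l bˡᵐ_k` are
totally symmetric in `i`, `j`, `m`. -/
structure IsHydrodynamicData (U : Set (Fin n → ℝ)) (h : (Fin n → ℝ) → Matrix (Fin n) (Fin n) ℝ)
    (b : (Fin n → ℝ) → Fin n → Fin n → Fin n → ℝ) : Prop where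
  isOpen : IsOpen U
  smooth : ∀ i j, ContDiffOn ℝ ∞ (fun w => h w i j) U
  symm : ∀ w ∈ U, ∀ i j, h w i j = h w j i
  pd_eq : ∀ w ∈ U, ∀ i j k, pd k (fun w => h w i j) w = 2 * b w i j k
  mul_h : ∀ w ∈ U, ∀ i j m, ∑ l, b w i j l * h w l m = ∑ l, b w i m l * h w l j
  mul_b : ∀ w ∈ U, ∀ i j m k, ∑ l, b w i j l * b w l m k = ∑ l, b w i m l * b w l j k

namespace IsHydrodynamicData

variable (hd : IsHydrodynamicData U h b)
include hd

theorem b_symm {w : Fin n → ℝ} (hw : w ∈ U) (i j k : Fin n) : b w i j k = b w j i k := by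
  have h1 : pd k (fun w => h w i j) w = pd k (fun w => h w j i) w :=
    dd_congr hd.isOpen (fun w hw => hd.symm w hw i j) hw _
  rw [hd.pd_eq w hw, hd.pd_eq w hw] at h1
  linarith

theorem smooth_b (i j k : Fin n) : ContDiffOn ℝ ∞ (fun w => b w i j k) U := by
  have h1 : ContDiffOn ℝ ∞ (fun w => (1 / 2 : ℝ) * pd k (fun w => h w i j) w) U :=
    contDiffOn_const.mul (dd_contDiffOn hd.isOpen (hd.smooth i j) _)
  refine h1.congr fun w hw => ?_
  rw [hd.pd_eq w hw]
  ring

end IsHydrodynamicData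

/-- The components of `h(u) ∂c/∂x + b(u) (∂u/∂x) c`. -/
noncomputable def hamFun (h : (Fin n → ℝ) → Matrix (Fin n) (Fin n) ℝ)
    (b : (Fin n → ℝ) → Fin n → Fin n → Fin n → ℝ) (u : Field U) (c : Covector n) (x : ℝ)
    (i : Fin n) : ℝ :=
  ∑ j, (h (u x) i j * deriv (fun y => c y j) x +
    ∑ k, b (u x) i j k * deriv (fun y => u y k) x * c x j)

/-- The components `bⁱʲ_l (a_i ∂c_j/∂x - c_j ∂a_i/∂x)` of the derivative of the bracket with respect
to its coefficients. -/
noncomputable def coeffFun (b : (Fin n → ℝ) → Fin n → Fin n → Fin n → ℝ) (u : Field U)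
    (a c : Covector n) (x : ℝ) (l : Fin n) : ℝ :=
  ∑ i, ∑ j, b (u x) i j l *
    (a x i * deriv (fun y => c y j) x - deriv (fun y => a y i) x * c x j)

theorem Field.deriv_periodic (u : Field U) (i : Fin n) (x : ℝ) :
    deriv (fun y => u y i) (x + 1) = deriv (fun y => u y i) x := by
  rw [← deriv_comp_add_const]
  simp only [u.periodic _]

theorem Field.hasDerivAt (u : Field U) (i : Fin n) (x : ℝ) :
    HasDerivAt (fun y => u y i) (deriv (fun y => u y i) x) x :=
  ((u.smooth_coord i).differentiable (by simp) x).hasDerivAt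

theorem Field.continuous_deriv (u : Field U) (i : Fin n) :
    Continuous fun x => deriv (fun y => u y i) x :=
  (u.smooth_coord i).continuous_deriv (by simp)

section Families

variable {E : Type*} [NormedAddCommGroup E] [NormedSpace ℝ E] {O : Set E} {v : E → Field U}
  {a c : E → Covector n}

theorem IsSmoothFamilyOn.lincomb (ha : IsSmoothFamilyOn O a) (r s : ℝ)
    (hc : IsSmoothFamilyOn O c) :
    IsSmoothFamilyOn O fun ε => lincomb r s (a ε) (c ε) :=
  ContDiffOn.add (ContDiffOn.const_smul r ha) (ContDiffOn.const_smul s hc)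

theorem IsSmoothFamilyOn.deriv_eq {V : Set (Fin n → ℝ)} {v : E → Field V}
    (hv : IsSmoothFamilyOn O v) (hO : IsOpen O) {ε : E}
    (hε : ε ∈ O) (i : Fin n) (x : ℝ) :
    deriv (fun y => v ε y i) x = dd (0, 1) (InfoFrobenius.coord v i) (ε, x) :=
  (hasDerivAt_slice hO (hv.coord i) hε x).deriv

theorem IsSmoothFamilyOn.contDiffOn_deriv {V : Set (Fin n → ℝ)} {v : E → Field V}
    (hv : IsSmoothFamilyOn O v) (hO : IsOpen O) (i : Fin n) :
    ContDiffOn ℝ ∞ (fun q : E × ℝ => deriv (fun y => v q.1 y i) q.2) (O ×ˢ Set.univ) :=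
  (dd_contDiffOn (hO.prod isOpen_univ) (hv.coord i) (0, 1)).congr fun q hq =>
    hv.deriv_eq hO hq.1 i q.2

theorem IsSmoothFamilyOn.comp_smooth {f : (Fin n → ℝ) → ℝ} (hf : ContDiffOn ℝ ∞ f U)
    (hv : IsSmoothFamilyOn O v) :
    ContDiffOn ℝ ∞ (fun q : E × ℝ => f (v q.1 q.2)) (O ×ˢ Set.univ) :=
  hf.comp hv fun q _ => (v q.1).mem q.2

theorem contDiffOn_hamFun (hd : IsHydrodynamicData U h b) (hO : IsOpen O)
    (hv : IsSmoothFamilyOn O v) (hc : IsSmoothFamilyOn O c) (i : Fin n) :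
    ContDiffOn ℝ ∞ (fun q : E × ℝ => hamFun h b (v q.1) (c q.1) q.2 i) (O ×ˢ Set.univ) :=
  ContDiffOn.sum fun j _ => ((hv.comp_smooth (hd.smooth i j)).mul (hc.contDiffOn_deriv hO j)).add
    (ContDiffOn.sum fun k _ => ((hv.comp_smooth (hd.smooth_b i j k)).mul
      (hv.contDiffOn_deriv hO k)).mul (hc.coord j))

theorem contDiffOn_coeffFun (hd : IsHydrodynamicData U h b) (hO : IsOpen O)
    (hv : IsSmoothFamilyOn O v) (ha : IsSmoothFamilyOn O a) (hc : IsSmoothFamilyOn O c)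
    (l : Fin n) :
    ContDiffOn ℝ ∞ (fun q : E × ℝ => coeffFun b (v q.1) (a q.1) (c q.1) q.2 l)
      (O ×ˢ Set.univ) :=
  ContDiffOn.sum fun i _ => ContDiffOn.sum fun j _ => (hv.comp_smooth (hd.smooth_b i j l)).mul
    (((ha.coord i).mul (hc.contDiffOn_deriv hO j)).sub
      ((ha.contDiffOn_deriv hO i).mul (hc.coord j)))

/-- The derivative of a smooth family of covector fields in the direction `e`. -/
noncomputable def familyDeriv (hO : IsOpen O) (ha : IsSmoothFamilyOn O a) {ε : E} (hε : ε ∈ O)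
    (e : E) : Covector n where
  toFun x i := dd (e, 0) (coord a i) (ε, x)
  smooth := contDiff_pi.mpr fun i =>
    contDiff_slice (dd_contDiffOn (hO.prod isOpen_univ) (ha.coord i) _) hε
  periodic x := funext fun i =>
    dd_periodic hO (fun ε _ x => by simp only [coord, (a ε).periodic x]) hε _ x
  mem _ := Set.mem_univ _

end Families

/-- The covector field `h(u) ∂c/∂x + b(u) (∂u/∂x) c`. -/
noncomputable def ham (hd : IsHydrodynamicData U h b) (u : Field U) (c : Covector n) :
    Covector n where
  toFun := hamFun h b u c
  smooth := contDiff_pi.mpr fun i => contDiff_slice (q := (0 : ℝ)) (contDiffOn_hamFun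
    (O := Set.univ) (v := fun _ : ℝ => u) (c := fun _ => c) hd isOpen_univ
    (isSmoothFamilyOn_const u) (isSmoothFamilyOn_const c) i) (Set.mem_univ _)
  periodic x := funext fun i => by
    simp only [hamFun, u.deriv_periodic, c.deriv_periodic, u.periodic x, c.periodic x]
  mem _ := Set.mem_univ _

/-- The covector field with the components `bⁱʲ_l (a_i ∂c_j/∂x - c_j ∂a_i/∂x)`. -/
noncomputable def coeffVar (hd : IsHydrodynamicData U h b) (u : Field U) (a c : Covector n) :
    Covector n where
  toFun := coeffFun b u a c
  smooth := contDiff_pi.mpr fun i => contDiff_slice (q := (0 : ℝ)) (contDiffOn_coeffFun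
    (O := Set.univ) (v := fun _ : ℝ => u) (a := fun _ => a) (c := fun _ => c) hd isOpen_univ
    (isSmoothFamilyOn_const u) (isSmoothFamilyOn_const a) (isSmoothFamilyOn_const c) i)
    (Set.mem_univ _)
  periodic x := funext fun i => by
    simp only [coeffFun, a.deriv_periodic, c.deriv_periodic, u.periodic x, a.periodic x,
      c.periodic x]
  mem _ := Set.mem_univ _

/-- The antisymmetric form `∫ hⁱʲ(u) (a_i ∂c_j/∂x - c_j ∂a_i/∂x) dx / 2` of the bracket. -/
noncomputable def skewForm (h : (Fin n → ℝ) → Matrix (Fin n) (Fin n) ℝ) (u : Field U)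
    (a c : Covector n) : ℝ :=
  ∫ x in (0 : ℝ)..1, ∑ i, ∑ j, h (u x) i j * (1 / 2 *
    (a x i * deriv (fun y => c y j) x - deriv (fun y => a y i) x * c x j))

theorem skewForm_swap (hd : IsHydrodynamicData U h b) (u : Field U) (a c : Covector n) :
    skewForm h u c a = -skewForm h u a c := by
  unfold skewForm
  rw [← intervalIntegral.integral_neg]
  refine intervalIntegral.integral_congr fun x _ => ?_
  rw [Finset.sum_comm]
  simp only [← Finset.sum_neg_distrib]
  refine Finset.sum_congr rfl fun i _ => Finset.sum_congr rfl fun j _ => ?_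
  rw [hd.symm _ (u.mem x) j i]
  ring

theorem IsHydrodynamicData.continuous_h (hd : IsHydrodynamicData U h b) (u : Field U)
    (i j : Fin n) : Continuous fun x => h (u x) i j :=
  (hd.smooth i j).continuousOn.comp_continuous u.smooth.continuous u.mem

theorem IsHydrodynamicData.continuous_b (hd : IsHydrodynamicData U h b) (u : Field U)
    (i j k : Fin n) : Continuous fun x => b (u x) i j k :=
  (hd.smooth_b i j k).continuousOn.comp_continuous u.smooth.continuous u.mem

theorem IsHydrodynamicData.hasDerivAt_h (hd : IsHydrodynamicData U h b) (u : Field U)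
    (i j : Fin n) (x : ℝ) :
    HasDerivAt (fun y => h (u y) i j) (∑ k, 2 * b (u x) i j k * deriv (fun y => u y k) x) x := by
  have hdiff : DifferentiableAt ℝ (fun y => h (u y) i j) x :=
    DifferentiableAt.comp (g := fun w => h w i j) x
      (differentiableAt_of_smooth hd.isOpen (hd.smooth i j) (u.mem x))
      (u.smooth.differentiable (by simp) x)
  have h1 := dd_comp_pi (z := (1 : ℝ)) isOpen_univ hd.isOpen (hd.smooth i j) u.smooth.contDiffOn
    (Set.mem_univ x) (u.mem x)
  have h2 := hdiff.hasDerivAt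
  have h3 : deriv (fun y => h (u y) i j) x = dd (1 : ℝ) (fun y => h (u y) i j) x := rfl
  rw [h3, h1] at h2
  simp only [hd.pd_eq _ (u.mem x)] at h2
  exact h2

theorem skewForm_intervalIntegrable (hd : IsHydrodynamicData U h b) (u : Field U)
    (a c : Covector n) : IntervalIntegrable (fun x => ∑ i, ∑ j, h (u x) i j * (1 / 2 *
      (a x i * deriv (fun y => c y j) x - deriv (fun y => a y i) x * c x j))) volume 0 1 :=
  Continuous.intervalIntegrable (continuous_finsetSum _ fun i _ => continuous_finsetSum _ fun j _ =>
    (hd.continuous_h u i j).mul (continuous_const.mul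
      (((a.continuous_coord i).mul (c.continuous_deriv j)).sub
        ((a.continuous_deriv i).mul (c.continuous_coord j))))) _ _

/-- The two integrands differ by the total derivative `½ ∂ₓ(hⁱʲ a_i c_j)`, because `∂ₓ h(u) = 2 b
uₓ`; its integral over a period is zero. -/
theorem pair_ham (hd : IsHydrodynamicData U h b) (u : Field U) (a c : Covector n) :
    pair a (ham hd u c) = skewForm h u a c := by
  have ha := a.continuous_coord
  have hc := c.continuous_coord
  have ha' := a.continuous_deriv
  have hc' := c.continuous_deriv
  have hu' := u.continuous_deriv
  have hh := hd.continuous_h u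
  have hb := hd.continuous_b u
  have hder : ∀ x, HasDerivAt (fun y => ∑ i, ∑ j, 1 / 2 * (h (u y) i j * (a y i * c y j)))
      (∑ i, ∑ j, 1 / 2 * ((∑ k, 2 * b (u x) i j k * deriv (fun y => u y k) x) * (a x i * c x j) +
        h (u x) i j * (deriv (fun y => a y i) x * c x j + a x i * deriv (fun y => c y j) x))) x :=
    fun x => HasDerivAt.fun_sum fun i _ => HasDerivAt.fun_sum fun j _ =>
      ((hd.hasDerivAt_h u i j x).mul ((a.hasDerivAt i x).mul (c.hasDerivAt j x))).const_mul _
  have h0 := integral_deriv_periodic hder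
    (continuous_finsetSum _ fun i _ => continuous_finsetSum _ fun j _ => continuous_const.mul
      (((continuous_finsetSum _ fun k _ => (continuous_const.mul (hb i j k)).mul (hu' k)).mul
        ((ha i).mul (hc j))).add
        ((hh i j).mul (((ha' i).mul (hc j)).add ((ha i).mul (hc' j)))))) fun x => by
    simp only [u.periodic x, a.periodic x, c.periodic x]
  rw [← sub_eq_zero, ← h0, pair, skewForm, ← intervalIntegral.integral_sub
    (pair_intervalIntegrable _ _) (skewForm_intervalIntegrable hd u a c)]
  refine intervalIntegral.integral_congr fun x _ => ?_
  simp only [ham, hamFun, ← Finset.sum_sub_distrib, Finset.mul_sum]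
  refine Finset.sum_congr rfl fun i _ => ?_
  refine Finset.sum_congr rfl fun j _ => ?_
  have hs : ∑ k, b (u x) i j k * deriv (fun y => u y k) x * c x j =
      (∑ k, b (u x) i j k * deriv (fun y => u y k) x) * c x j := by rw [Finset.sum_mul]
  have hs' : ∑ k, 2 * b (u x) i j k * deriv (fun y => u y k) x =
      2 * ∑ k, b (u x) i j k * deriv (fun y => u y k) x := by
    rw [Finset.mul_sum]
    exact Finset.sum_congr rfl fun k _ => by ring
  rw [hs, hs']
  ring

theorem skewForm_lincomb_left (hd : IsHydrodynamicData U h b) (u : Field U) (r s : ℝ)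
    (a a' c : Covector n) :
    skewForm h u (lincomb r s a a') c = r * skewForm h u a c + s * skewForm h u a' c := by
  simp only [← pair_ham hd, pair_lincomb]

theorem skewForm_lincomb_right (hd : IsHydrodynamicData U h b) (u : Field U) (r s : ℝ)
    (a c c' : Covector n) :
    skewForm h u a (lincomb r s c c') = r * skewForm h u a c + s * skewForm h u a c' := by
  rw [skewForm_swap hd u _ a, skewForm_lincomb_left hd, skewForm_swap hd u a c,
    skewForm_swap hd u a c']
  ring

section Families

variable {E : Type*} [NormedAddCommGroup E] [NormedSpace ℝ E] {O : Set E} {v : E → Field U}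
  {a c : E → Covector n}

/-- The integrand of the skew form, as a function on the product with the line. -/
noncomputable def skewDensity (h : (Fin n → ℝ) → Matrix (Fin n) (Fin n) ℝ) (v : E → Field U)
    (a c : E → Covector n) (i j : Fin n) (q : E × ℝ) : ℝ :=
  h (v q.1 q.2) i j * (1 / 2 * (coord a i q * dd (0, 1) (coord c j) q -
    dd (0, 1) (coord a i) q * coord c j q))

theorem contDiffOn_skewDensity (hd : IsHydrodynamicData U h b) (hO : IsOpen O)
    (hv : IsSmoothFamilyOn O v) (ha : IsSmoothFamilyOn O a) (hc : IsSmoothFamilyOn O c)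
    (i j : Fin n) : ContDiffOn ℝ ∞ (skewDensity h v a c i j) (O ×ˢ Set.univ) := by
  have hΩ := hO.prod (isOpen_univ (X := ℝ))
  exact (hv.comp_smooth (hd.smooth i j)).mul (contDiffOn_const.mul
    (((ha.coord i).mul (dd_contDiffOn hΩ (hc.coord j) _)).sub
      ((dd_contDiffOn hΩ (ha.coord i) _).mul (hc.coord j))))

theorem skewForm_eq_integral (hO : IsOpen O)
    (ha : IsSmoothFamilyOn O a) (hc : IsSmoothFamilyOn O c) {ε : E} (hε : ε ∈ O) :
    skewForm h (v ε) (a ε) (c ε) =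
      ∫ x in (0 : ℝ)..1, ∑ i, ∑ j, skewDensity h v a c i j (ε, x) := by
  simp only [skewForm, skewDensity, ha.deriv_eq hO hε, hc.deriv_eq hO hε, coord]

theorem dd_skewDensity (hd : IsHydrodynamicData U h b) (hO : IsOpen O)
    (hv : IsSmoothFamilyOn O v) (ha : IsSmoothFamilyOn O a) (hc : IsSmoothFamilyOn O c)
    {ε : E} (hε : ε ∈ O) (e : E) (i j : Fin n) (x : ℝ) :
    dd (e, 0) (skewDensity h v a c i j) (ε, x) =
      (∑ l, b (v ε x) i j l * dd (e, 0) (coord v l) (ε, x)) *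
        (a ε x i * deriv (fun y => c ε y j) x - deriv (fun y => a ε y i) x * c ε x j) +
      h (v ε x) i j * (1 / 2 * (familyDeriv hO ha hε e x i * deriv (fun y => c ε y j) x -
        deriv (fun y => familyDeriv hO ha hε e y i) x * c ε x j)) +
      h (v ε x) i j * (1 / 2 * (a ε x i * deriv (fun y => familyDeriv hO hc hε e y j) x -
        deriv (fun y => a ε y i) x * familyDeriv hO hc hε e x j)) := by
  have hΩ := hO.prod (isOpen_univ (X := ℝ))
  have hq : (ε, x) ∈ O ×ˢ (Set.univ : Set ℝ) := ⟨hε, Set.mem_univ x⟩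
  -- The parameter derivative commutes with `∂ₓ`. Below, the factor `2` in `∂h = 2b` cancels the `1
  -- / 2` of the density.
  have hder : ∀ {a : E → Covector n} (ha : IsSmoothFamilyOn O a) (i : Fin n),
      deriv (fun y => familyDeriv hO ha hε e y i) x = dd (e, 0) (dd (0, 1) (coord a i)) (ε, x) := by
    intro a ha i
    rw [dd_comm hΩ (ha.coord i) hq]
    exact (hasDerivAt_slice hO (dd_contDiffOn hΩ (ha.coord i) _) hε x).deriv
  have hai := ha.coord i
  have hcj := hc.coord j
  have hai' := dd_contDiffOn hΩ hai ((0 : E), (1 : ℝ))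
  have hcj' := dd_contDiffOn hΩ hcj ((0 : E), (1 : ℝ))
  have hcv : ∀ k, dd (e, (0 : ℝ)) (fun q : E × ℝ => v q.1 q.2 k) = dd (e, 0) (coord v k) :=
    fun _ => rfl
  unfold skewDensity
  rw [dd_mul hΩ (hv.comp_smooth (hd.smooth i j))
      (contDiffOn_const.mul ((hai.mul hcj').sub (hai'.mul hcj))) hq,
    dd_const_mul hΩ ((hai.mul hcj').sub (hai'.mul hcj)) hq,
    dd_sub hΩ (hai.mul hcj') (hai'.mul hcj) hq, dd_mul hΩ hai hcj' hq, dd_mul hΩ hai' hcj hq,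
    dd_comp_pi hΩ hd.isOpen (hd.smooth i j) hv hq ((v ε).mem x)]
  simp only [hcv, hd.pd_eq _ ((v ε).mem x), hder, ha.deriv_eq hO hε, hc.deriv_eq hO hε, mul_assoc,
    ← Finset.mul_sum]
  simp only [familyDeriv, coord]
  ring

variable [FiniteDimensional ℝ E]

theorem contDiffOn_skewForm (hd : IsHydrodynamicData U h b) (hO : IsOpen O)
    (hv : IsSmoothFamilyOn O v) (ha : IsSmoothFamilyOn O a) (hc : IsSmoothFamilyOn O c) :
    ContDiffOn ℝ ∞ (fun ε => skewForm h (v ε) (a ε) (c ε)) O :=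
  (contDiffOn_integral hO (ContDiffOn.sum fun i _ => ContDiffOn.sum fun j _ =>
    contDiffOn_skewDensity hd hO hv ha hc i j)).congr fun _ hε =>
      skewForm_eq_integral hO ha hc hε

/-- The form is varied in its coefficients `h(v)`, which gives `coeffVar`, and in its two arguments.
The last two terms are brought to the shape `pair _ (ham _)` by skew-adjointness, whence the minus
sign. -/
theorem fderiv_skewForm (hd : IsHydrodynamicData U h b) (hO : IsOpen O)
    (hv : IsSmoothFamilyOn O v) (ha : IsSmoothFamilyOn O a) (hc : IsSmoothFamilyOn O c)
    {ε : E} (hε : ε ∈ O) (e : E) :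
    fderiv ℝ (fun ε => skewForm h (v ε) (a ε) (c ε)) ε e =
      (∫ x in (0 : ℝ)..1, ∑ l, coeffVar hd (v ε) (a ε) (c ε) x l * dd (e, 0) (coord v l) (ε, x)) +
      pair (familyDeriv hO ha hε e) (ham hd (v ε) (c ε)) -
      pair (familyDeriv hO hc hε e) (ham hd (v ε) (a ε)) := by
  have hΩ := hO.prod (isOpen_univ (X := ℝ))
  have hS := contDiffOn_skewDensity hd hO hv ha hc
  have h1 : fderiv ℝ (fun ε => skewForm h (v ε) (a ε) (c ε)) ε e =
      ∫ x in (0 : ℝ)..1, ∑ i, ∑ j, dd (e, 0) (skewDensity h v a c i j) (ε, x) := by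
    have h2 := dd_congr (f := fun ε => skewForm h (v ε) (a ε) (c ε)) hO
      (fun ε' hε' => skewForm_eq_integral hO ha hc hε') hε e
    refine h2.trans ((fderiv_integral hO (ContDiffOn.sum fun i _ =>
      ContDiffOn.sum fun j _ => hS i j) hε e).trans ?_)
    refine intervalIntegral.integral_congr fun x _ => ?_
    have hq : (ε, x) ∈ O ×ˢ (Set.univ : Set ℝ) := ⟨hε, Set.mem_univ x⟩
    rw [dd_sum hΩ (fun i => ContDiffOn.sum fun j _ => hS i j) hq]
    exact Finset.sum_congr rfl fun i _ => dd_sum hΩ (hS i) hq _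
  have hneg : -pair (familyDeriv hO hc hε e) (ham hd (v ε) (a ε)) =
      skewForm h (v ε) (a ε) (familyDeriv hO hc hε e) := by
    rw [pair_ham, skewForm_swap hd, neg_neg]
  have hcont := skewForm_intervalIntegrable hd (v ε)
  have hcoeff : IntervalIntegrable (fun x => ∑ l, coeffVar hd (v ε) (a ε) (c ε) x l *
      dd (e, 0) (coord v l) (ε, x)) volume 0 1 :=
    Continuous.intervalIntegrable (continuous_finsetSum _ fun l _ =>
      ((coeffVar hd (v ε) (a ε) (c ε)).continuous_coord l).mul
        (contDiff_slice (dd_contDiffOn hΩ (hv.coord l) (e, 0)) hε).continuous) _ _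
  rw [sub_eq_add_neg, hneg, pair_ham, skewForm, skewForm, h1,
    ← intervalIntegral.integral_add hcoeff (hcont _ _),
    ← intervalIntegral.integral_add (hcoeff.add (hcont _ _)) (hcont _ _)]
  refine intervalIntegral.integral_congr fun x _ => ?_
  simp only [dd_skewDensity hd hO hv ha hc hε, Finset.sum_add_distrib]
  congr 2
  simp only [coeffVar, coeffFun, Finset.sum_mul]
  conv_rhs => rw [Finset.sum_comm]
  refine Finset.sum_congr rfl fun i _ => ?_
  conv_rhs => rw [Finset.sum_comm]
  refine Finset.sum_congr rfl fun j _ => Finset.sum_congr rfl fun l _ => ?_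
  ring

end Families

variable {F G : Field U → ℝ} {δ γ : Field U → Covector n}

/-- The gradient of the bracket of two functionals. -/
noncomputable def bracketGrad (hd : IsHydrodynamicData U h b) (hF : IsVariationalDerivative F δ)
    (hG : IsVariationalDerivative G γ) (u : Field U) : Covector n :=
  lincomb 1 1 (lincomb 1 (-1) (secondVar hd.isOpen hF u (ham hd u (γ u)))
    (secondVar hd.isOpen hG u (ham hd u (δ u)))) (coeffVar hd u (δ u) (γ u))

/-- In the derivative of the skew form, the variations of `δ` and `γ` are paired with `P γ` and `P
δ`. The adjointness `pair_secondVar_family` moves them onto the velocity of `v`, leaving an explicit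
gradient. -/
theorem isVariationalDerivative_bracket (hd : IsHydrodynamicData U h b)
    (hF : IsVariationalDerivative F δ) (hG : IsVariationalDerivative G γ) :
    IsVariationalDerivative (fun u => skewForm h u (δ u) (γ u)) (bracketGrad hd hF hG) where
  smooth m W v hW hv :=
    contDiffOn_skewForm hd hW hv (hF.smooth_grad m W v hW hv) (hG.smooth_grad m W v hW hv)
  smooth_grad m W v hW hv := by
    have ha : IsSmoothFamilyOn W fun ε => δ (v ε) := hF.smooth_grad m W v hW hv
    have hc : IsSmoothFamilyOn W fun ε => γ (v ε) := hG.smooth_grad m W v hW hv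
    have hPa : IsSmoothFamilyOn W fun ε => ham hd (v ε) (δ (v ε)) :=
      contDiffOn_pi.mpr fun i => contDiffOn_hamFun hd hW hv ha i
    have hPc : IsSmoothFamilyOn W fun ε => ham hd (v ε) (γ (v ε)) :=
      contDiffOn_pi.mpr fun i => contDiffOn_hamFun hd hW hv hc i
    have hT : IsSmoothFamilyOn W fun ε => coeffVar hd (v ε) (δ (v ε)) (γ (v ε)) :=
      contDiffOn_pi.mpr fun i => contDiffOn_coeffFun hd hW hv ha hc i
    have h1 := IsSmoothFamilyOn.secondVar hd.isOpen hF hW hv hPc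
    have h2 := IsSmoothFamilyOn.secondVar hd.isOpen hG hW hv hPa
    exact (h1.lincomb 1 (-1) h2).lincomb 1 1 hT
  fderiv_eq m W v hW hv ε hε e := by
    have hv' : IsSmoothFamilyOn W v := hv
    have ha : IsSmoothFamilyOn W fun ε => δ (v ε) := hF.smooth_grad m W v hW hv
    have hc : IsSmoothFamilyOn W fun ε => γ (v ε) := hG.smooth_grad m W v hW hv
    have hΩ := hW.prod (isOpen_univ (X := ℝ))
    have hpair : ∀ a : Covector n, IntervalIntegrable
        (fun x => ∑ i, a x i * dd (e, 0) (coord v i) (ε, x)) volume 0 1 := fun a =>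
      Continuous.intervalIntegrable (continuous_finsetSum _ fun l _ => (a.continuous_coord l).mul
        (contDiff_slice (dd_contDiffOn hΩ (hv'.coord l) (e, 0)) hε).continuous) _ _
    have h1 := pair_secondVar_family hd.isOpen hF hW hv' hε e (ham hd (v ε) (γ (v ε)))
    have h2 := pair_secondVar_family hd.isOpen hG hW hv' hε e (ham hd (v ε) (δ (v ε)))
    have h3 : ∀ x i, fderiv ℝ (fun ε' => v ε' x i) ε e = dd (e, 0) (coord v i) (ε, x) :=
      fun x i => fderiv_slice hW (hv'.coord i) hε x e
    simp only [h3]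
    rw [fderiv_skewForm hd hW hv' ha hc hε e]
    simp only [pair]
    rw [show (∫ x in (0 : ℝ)..1, ∑ i, familyDeriv hW ha hε e x i *
        ham hd (v ε) (γ (v ε)) x i) = _ from h1,
      show (∫ x in (0 : ℝ)..1, ∑ i, familyDeriv hW hc hε e x i *
        ham hd (v ε) (δ (v ε)) x i) = _ from h2,
      ← intervalIntegral.integral_add (hpair _) (hpair _),
      ← intervalIntegral.integral_sub ((hpair _).add (hpair _)) (hpair _)]
    refine intervalIntegral.integral_congr fun x _ => ?_
    simp only [← Finset.sum_add_distrib, ← Finset.sum_sub_distrib]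
    refine Finset.sum_congr rfl fun i _ => ?_
    simp only [bracketGrad, lincomb, Pi.add_apply, Pi.smul_apply, smul_eq_mul]
    ring

/-- The bracket of hydrodynamic type. -/
noncomputable def bracket (hd : IsHydrodynamicData U h b) :
    smoothFunctionals U →ₗ[ℝ] smoothFunctionals U →ₗ[ℝ] smoothFunctionals U :=
  LinearMap.mk₂ ℝ (fun F G => ⟨fun u => skewForm h u (grad F u) (grad G u), _,
      isVariationalDerivative_bracket hd (grad_spec F) (grad_spec G)⟩)
    (fun F F' G => Subtype.ext <| funext fun u => by
      simp [grad_add hd.isOpen, skewForm_lincomb_left hd])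
    (fun r F G => Subtype.ext <| funext fun u => by
      simp [grad_smul hd.isOpen, skewForm_lincomb_left hd])
    (fun F G G' => Subtype.ext <| funext fun u => by
      simp [grad_add hd.isOpen, skewForm_lincomb_right hd])
    (fun r F G => Subtype.ext <| funext fun u => by
      simp [grad_smul hd.isOpen, skewForm_lincomb_right hd])

theorem bracket_apply (hd : IsHydrodynamicData U h b) (F G : smoothFunctionals U) (u : Field U) :
    (bracket hd F G : Field U → ℝ) u = skewForm h u (grad F u) (grad G u) := rfl

theorem grad_bracket (hd : IsHydrodynamicData U h b) (F G : smoothFunctionals U) :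
    grad (bracket hd F G) = bracketGrad hd (grad_spec F) (grad_spec G) :=
  (IsVariationalDerivative.eq_grad hd.isOpen (bracket hd F G)
    (isVariationalDerivative_bracket hd (grad_spec F) (grad_spec G))).symm

/-- Uniqueness of gradients makes the formula independent of the variational derivatives chosen to
define the bracket. -/
theorem isHydrodynamicType_bracket (hd : IsHydrodynamicData U h b) :
    IsHydrodynamicType h b (bracket hd) := by
  intro F G δF δG hF hG u
  rw [bracket_apply, ← pair_ham hd, hF.eq_grad hd.isOpen, hG.eq_grad hd.isOpen]
  simp only [pair, ham, hamFun, Finset.mul_sum]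

theorem bracket_bracket_apply (hd : IsHydrodynamicData U h b) (F G H : smoothFunctionals U)
    (u : Field U) :
    (bracket hd (bracket hd F G) H : Field U → ℝ) u =
      pair (secondVar hd.isOpen (grad_spec F) u (ham hd u (grad G u))) (ham hd u (grad H u)) -
      pair (secondVar hd.isOpen (grad_spec G) u (ham hd u (grad F u))) (ham hd u (grad H u)) +
      pair (coeffVar hd u (grad F u) (grad G u)) (ham hd u (grad H u)) := by
  rw [bracket_apply, ← pair_ham hd, grad_bracket, bracketGrad, pair_lincomb, pair_lincomb]
  ring

theorem coeffVar_cyclic (hd : IsHydrodynamicData U h b) (u : Field U) (a c e : Covector n) :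
    pair (coeffVar hd u a c) (ham hd u e) + pair (coeffVar hd u c e) (ham hd u a) +
      pair (coeffVar hd u e a) (ham hd u c) = 0 := by
  simp only [pair]
  rw [← intervalIntegral.integral_add (pair_intervalIntegrable _ _) (pair_intervalIntegrable _ _),
    ← intervalIntegral.integral_add ((pair_intervalIntegrable _ _).add
      (pair_intervalIntegrable _ _)) (pair_intervalIntegrable _ _)]
  refine (intervalIntegral.integral_congr fun x _ => ?_).trans intervalIntegral.integral_zero
  exact cyclic_sum_eq_zero (fun i j k => hd.b_symm (u.mem x) i j k) (hd.mul_h _ (u.mem x))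
    (hd.mul_b _ (u.mem x)) (a x) (c x) (e x) (fun j => deriv (fun y => a y j) x)
    (fun j => deriv (fun y => c y j) x) (fun j => deriv (fun y => e y j) x)
    fun k => deriv (fun y => u y k) x

theorem isPoissonBracket_bracket (hd : IsHydrodynamicData U h b) :
    IsPoissonBracket (bracket hd) where
  alternating F := Subtype.ext <| funext fun u => by
    have h1 := skewForm_swap hd u (grad F u) (grad F u)
    have h2 : skewForm h u (grad F u) (grad F u) = 0 := by linarith
    exact h2
  jacobi F G H := Subtype.ext <| funext fun u => by
    -- Each of the three second variations occurs twice in the cyclic sum, with its arguments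
    -- exchanged and opposite signs; the coefficient terms vanish by `coeffVar_cyclic`.
    have h1 := coeffVar_cyclic hd u (grad F u) (grad G u) (grad H u)
    have h2 := pair_secondVar_comm hd.isOpen (grad_spec F) u (ham hd u (grad G u))
      (ham hd u (grad H u))
    have h3 := pair_secondVar_comm hd.isOpen (grad_spec G) u (ham hd u (grad F u))
      (ham hd u (grad H u))
    have h4 := pair_secondVar_comm hd.isOpen (grad_spec H) u (ham hd u (grad F u))
      (ham hd u (grad G u))
    change (bracket hd (bracket hd F G) H : Field U → ℝ) u +
      (bracket hd (bracket hd G H) F : Field U → ℝ) u +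
      (bracket hd (bracket hd H F) G : Field U → ℝ) u = 0
    rw [bracket_bracket_apply, bracket_bracket_apply, bracket_bracket_apply]
    linarith
  leibniz F G H := Subtype.ext <| funext fun u => by
    change (bracket hd F (G * H) : Field U → ℝ) u =
      (bracket hd F G : Field U → ℝ) u * (H : Field U → ℝ) u +
      (G : Field U → ℝ) u * (bracket hd F H : Field U → ℝ) u
    simp only [bracket_apply, grad_mul hd.isOpen, skewForm_lincomb_right hd]
    ring

end Bracket

/-! ### Smoothness of the log-partition function. -/

section ExponentialFamilies

variable {n : ℕ} {S : Type*} [MeasurableSpace S] {μ : Measure S} {X : Fin n → S → ℝ}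
  {Θ : Set (Fin n → ℝ)}

/-- The left side is the summand whose signs are opposite to those of `X`. The right side evaluates
the exponential at the vertices of a cube around `θ`, where integrability is available. -/
theorem exp_add_abs_le_sum (X θ : Fin n → ℝ) (R : ℝ) :
    Real.exp (-∑ j, θ j * X j + R * ∑ j, |X j|) ≤
      ∑ p : Fin n → Bool, Real.exp (-∑ j, (θ j + if p j then R else -R) * X j) := by
  have h : Real.exp (-∑ j, θ j * X j + R * ∑ j, |X j|) =
      Real.exp (-∑ j, (θ j + if (decide (X j < 0)) then R else -R) * X j) := by
    congr 1
    rw [Finset.mul_sum, ← Finset.sum_neg_distrib, ← Finset.sum_neg_distrib,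
      ← Finset.sum_add_distrib]
    refine Finset.sum_congr rfl fun j _ => ?_
    by_cases hj : X j < 0
    · simp only [hj, abs_of_neg hj, decide_true, if_true]
      ring
    · simp only [hj, abs_of_nonneg (not_lt.mp hj), decide_false, Bool.false_eq_true, if_false]
      ring
  rw [h]
  exact Finset.single_le_sum
    (f := fun p : Fin n → Bool => Real.exp (-∑ j, (θ j + if p j then R else -R) * X j))
    (fun p _ => (Real.exp_pos _).le) (Finset.mem_univ fun j => decide (X j < 0))

/-- The linear functional `θ ↦ ∑ⱼ Xⱼ θʲ`. -/
noncomputable def statFunctional (X : Fin n → ℝ) : (Fin n → ℝ) →L[ℝ] ℝ :=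
  ∑ j, X j • ContinuousLinearMap.proj (R := ℝ) (φ := fun _ : Fin n => ℝ) j

theorem statFunctional_apply (X z : Fin n → ℝ) : statFunctional X z = ∑ j, X j * z j := by
  simp [statFunctional]

theorem norm_statFunctional_le (X : Fin n → ℝ) : ‖statFunctional X‖ ≤ ∑ j, |X j| := by
  refine ContinuousLinearMap.opNorm_le_bound _ (Finset.sum_nonneg fun j _ => abs_nonneg _)
    fun z => ?_
  rw [statFunctional_apply, Finset.sum_mul]
  refine (norm_sum_le _ _).trans (Finset.sum_le_sum fun j _ => ?_)
  rw [norm_mul, Real.norm_eq_abs]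
  exact mul_le_mul_of_nonneg_left (norm_le_pi_norm z j) (abs_nonneg _)

theorem hasFDerivAt_exp_stat (X θ : Fin n → ℝ) (a : ℝ) :
    HasFDerivAt (fun θ : Fin n → ℝ => a * Real.exp (-∑ j, θ j * X j))
      ((a * Real.exp (-∑ j, θ j * X j)) • -statFunctional X) θ := by
  have h : (fun θ : Fin n → ℝ => a * Real.exp (-∑ j, θ j * X j)) =
      fun θ => a * Real.exp ((-statFunctional X) θ) := by
    funext θ
    simp [statFunctional_apply, mul_comm]
  have h2 : Real.exp (-∑ j, θ j * X j) = Real.exp ((-statFunctional X) θ) := by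
    simp [statFunctional_apply, mul_comm]
  rw [h, h2, mul_smul]
  exact ((-statFunctional X).hasFDerivAt.exp).const_mul a

/-- With `A = ∑ |X_j|`, one factor `exp (r A)` accounts for moving `θ` within the ball, and another
absorbs the linear growth through `A ≤ r⁻¹ exp (r A)`; hence `2 * r`. -/
theorem norm_fderiv_exp_stat_le (X θ θ₀ : Fin n → ℝ) (a : ℝ) {r : ℝ} (hr : 0 < r)
    (hθ : θ ∈ Metric.ball θ₀ r) :
    ‖(a * Real.exp (-∑ j, θ j * X j)) • -statFunctional X‖ ≤
      r⁻¹ * (|a| * Real.exp (-∑ j, θ₀ j * X j + (2 * r) * ∑ j, |X j|)) := by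
  set A := ∑ j, |X j| with hA
  have hA0 : 0 ≤ A := Finset.sum_nonneg fun j _ => abs_nonneg _
  have h1 : -∑ j, θ j * X j ≤ -∑ j, θ₀ j * X j + r * A := by
    rw [hA, Finset.mul_sum, ← Finset.sum_neg_distrib, ← Finset.sum_neg_distrib,
      ← Finset.sum_add_distrib]
    refine Finset.sum_le_sum fun j _ => ?_
    have hj : |θ j - θ₀ j| ≤ r :=
      (norm_le_pi_norm (θ - θ₀) j).trans (by rw [← dist_eq_norm]; exact (Metric.mem_ball.mp hθ).le)
    have : -((θ j - θ₀ j) * X j) ≤ r * |X j| := by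
      refine (neg_le_abs _).trans ?_
      rw [abs_mul]
      exact mul_le_mul_of_nonneg_right hj (abs_nonneg _)
    linarith
  have h2 : A ≤ r⁻¹ * Real.exp (r * A) := by
    have := Real.add_one_le_exp (r * A)
    rw [← div_eq_inv_mul, le_div_iff₀ hr]
    linarith
  rw [norm_smul, norm_neg, norm_mul, Real.norm_eq_abs, Real.norm_eq_abs, Real.abs_exp]
  calc |a| * Real.exp (-∑ j, θ j * X j) * ‖statFunctional X‖
      ≤ |a| * Real.exp (-∑ j, θ₀ j * X j + r * A) * (r⁻¹ * Real.exp (r * A)) := by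
        gcongr
        exact (norm_statFunctional_le X).trans h2
    _ = r⁻¹ * (|a| * (Real.exp (-∑ j, θ₀ j * X j + r * A) * Real.exp (r * A))) := by ring
    _ = _ := by
        rw [← Real.exp_add]
        congr 3
        ring

variable {f : S → ℝ}

theorem measurable_exp_stat (hX : ∀ j, Measurable (X j)) (θ : Fin n → ℝ) :
    Measurable fun s => Real.exp (-∑ j, θ j * X j s) :=
  Real.measurable_exp.comp (Finset.measurable_fun_sum _ fun j _ => (hX j).const_mul _).neg

theorem integrable_bound (hX : ∀ j, Measurable (X j)) (hf : Measurable f)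
    (hint : ∀ θ ∈ Θ, Integrable (fun s => f s * Real.exp (-∑ j, θ j * X j s)) μ)
    {θ₀ : Fin n → ℝ} {R : ℝ} (hR : 0 ≤ R) (hball : Metric.closedBall θ₀ R ⊆ Θ) :
    Integrable (fun s => |f s| * Real.exp (-∑ j, θ₀ j * X j s + R * ∑ j, |X j s|)) μ := by
  have hsum : Integrable (fun s => ∑ p : Fin n → Bool,
      |f s| * Real.exp (-∑ j, (θ₀ j + if p j then R else -R) * X j s)) μ := by
    refine integrable_finsetSum _ fun p _ => ?_
    -- The norm is the supremum norm, so the vertices of the cube lie in the closed ball of radius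
    -- `R`.
    have hp : (fun j => θ₀ j + if p j then R else -R) ∈ Θ := by
      refine hball ?_
      rw [Metric.mem_closedBall, dist_pi_le_iff hR]
      intro j
      rw [Real.dist_eq, add_sub_cancel_left]
      split_ifs <;> simp [abs_of_nonneg hR]
    refine (hint _ hp).abs.congr (Filter.Eventually.of_forall fun s => ?_)
    simp only [abs_mul, Real.abs_exp]
  refine hsum.mono' ?_ (Filter.Eventually.of_forall fun s => ?_)
  · refine (hf.abs.mul (Real.measurable_exp.comp ?_)).aestronglyMeasurable
    exact (Finset.measurable_fun_sum _ fun j _ => (hX j).const_mul _).neg.add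
      ((Finset.measurable_fun_sum _ fun j _ => (hX j).abs).const_mul _)
  · rw [norm_mul, Real.norm_eq_abs, Real.norm_eq_abs, abs_abs, Real.abs_exp, ← Finset.mul_sum]
    exact mul_le_mul_of_nonneg_left (exp_add_abs_le_sum (fun j => X j s) θ₀ R) (abs_nonneg _)

theorem measurable_statFunctional (hX : ∀ j, Measurable (X j)) :
    StronglyMeasurable fun s => statFunctional fun j => X j s :=
  Finset.stronglyMeasurable_fun_sum _ fun j _ => (hX j).stronglyMeasurable.smul_const _

theorem hasFDerivAt_integral_exp_stat (hX : ∀ j, Measurable (X j)) (hΘ : IsOpen Θ)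
    (hf : Measurable f)
    (hint : ∀ θ ∈ Θ, Integrable (fun s => f s * Real.exp (-∑ j, θ j * X j s)) μ)
    {θ₀ : Fin n → ℝ} (hθ₀ : θ₀ ∈ Θ) :
    Integrable (fun s => (f s * Real.exp (-∑ j, θ₀ j * X j s)) • -statFunctional fun j => X j s) μ ∧
      HasFDerivAt (fun θ => ∫ s, f s * Real.exp (-∑ j, θ j * X j s) ∂μ)
        (∫ s, (f s * Real.exp (-∑ j, θ₀ j * X j s)) • -statFunctional (fun j => X j s) ∂μ) θ₀ := by
  obtain ⟨R, hR, hball⟩ := Metric.nhds_basis_closedBall.mem_iff.mp (hΘ.mem_nhds hθ₀)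
  obtain ⟨r, hr, rfl⟩ : ∃ r, 0 < r ∧ R = 2 * r := ⟨R / 2, by positivity, by ring⟩
  have hbound := (integrable_bound hX hf hint hR.le hball).const_mul r⁻¹
  have hmeas : AEStronglyMeasurable (fun s =>
      (f s * Real.exp (-∑ j, θ₀ j * X j s)) • -statFunctional fun j => X j s) μ :=
    (hint θ₀ hθ₀).aestronglyMeasurable.smul (measurable_statFunctional hX).neg.aestronglyMeasurable
  have hle : ∀ s, ∀ θ ∈ Metric.ball θ₀ r,
      ‖(f s * Real.exp (-∑ j, θ j * X j s)) • -statFunctional fun j => X j s‖ ≤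
        r⁻¹ * (|f s| * Real.exp (-∑ j, θ₀ j * X j s + (2 * r) * ∑ j, |X j s|)) := fun s θ hθ =>
    norm_fderiv_exp_stat_le (fun j => X j s) θ θ₀ (f s) hr hθ
  refine ⟨hbound.mono' hmeas (Filter.Eventually.of_forall fun s =>
    hle s θ₀ (Metric.mem_ball_self hr)), ?_⟩
  have hm : ∀ᶠ θ : Fin n → ℝ in 𝓝 θ₀,
      AEStronglyMeasurable (fun s => f s * Real.exp (-∑ j, θ j * X j s)) μ :=
    Filter.Eventually.of_forall fun θ => (hf.mul (measurable_exp_stat hX θ)).aestronglyMeasurable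
  have hdiff : ∀ᵐ s ∂μ, ∀ θ ∈ Metric.ball θ₀ r,
      HasFDerivAt (fun θ : Fin n → ℝ => f s * Real.exp (-∑ j, θ j * X j s))
        ((f s * Real.exp (-∑ j, θ j * X j s)) • -statFunctional fun j => X j s) θ :=
    Filter.Eventually.of_forall fun s θ _ => hasFDerivAt_exp_stat (fun j => X j s) θ (f s)
  have hmain := hasFDerivAt_integral_of_dominated_of_fderiv_le (𝕜 := ℝ) (μ := μ) (x₀ := θ₀)
    (F := fun θ s => f s * Real.exp (-∑ j, θ j * X j s))
    (F' := fun θ s => (f s * Real.exp (-∑ j, θ j * X j s)) • -statFunctional fun j => X j s)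
    (s := Metric.ball θ₀ r)
    (bound := fun s => r⁻¹ * (|f s| * Real.exp (-∑ j, θ₀ j * X j s + (2 * r) * ∑ j, |X j s|)))
    (Metric.ball_mem_nhds θ₀ hr) hm (hint θ₀ hθ₀) hmeas (Filter.Eventually.of_forall hle) hbound
    hdiff
  exact hmain

/-- Laplace transforms are smooth in the interior of their domain. -/
theorem contDiffOn_integral_exp_stat (hX : ∀ j, Measurable (X j)) (hΘ : IsOpen Θ)
    (hf : Measurable f)
    (hint : ∀ θ ∈ Θ, Integrable (fun s => f s * Real.exp (-∑ j, θ j * X j s)) μ) :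
    ContDiffOn ℝ ∞ (fun θ => ∫ s, f s * Real.exp (-∑ j, θ j * X j s) ∂μ) Θ := by
  -- The class of all such transforms is closed under differentiation: the derivative along `z`
  -- replaces `f` by `-f ∑ X_j z_j`, and integrability survives on the open set `Θ`.
  refine contDiffOn_infty_of_fderiv_mem hΘ
    {G | ∃ f : S → ℝ, Measurable f ∧
      (∀ θ ∈ Θ, Integrable (fun s => f s * Real.exp (-∑ j, θ j * X j s)) μ) ∧
      G = fun θ => ∫ s, f s * Real.exp (-∑ j, θ j * X j s) ∂μ} ?_
    (Exists.intro f ⟨hf, hint, rfl⟩)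
  rintro _ ⟨f, hf, hint, rfl⟩
  have hF := fun {θ} (hθ : θ ∈ Θ) => hasFDerivAt_integral_exp_stat hX hΘ hf hint hθ
  refine ⟨fun θ hθ => (hF hθ).2.differentiableAt.differentiableWithinAt, fun z => ?_⟩
  have heq : ∀ (θ : Fin n → ℝ) s, ((f s * Real.exp (-∑ j, θ j * X j s)) • -statFunctional fun j => X j s) z =
      (-(f s * ∑ j, X j s * z j)) * Real.exp (-∑ j, θ j * X j s) := by
    intro θ s
    simp only [smul_apply, neg_apply, statFunctional_apply, smul_eq_mul]
    ring
  refine ⟨fun θ => ∫ s, (-(f s * ∑ j, X j s * z j)) * Real.exp (-∑ j, θ j * X j s) ∂μ,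
    ⟨fun s => -(f s * ∑ j, X j s * z j),
      (hf.mul (Finset.measurable_fun_sum _ fun j _ => (hX j).mul_const _)).neg,
      fun θ hθ => ?_, rfl⟩, fun θ hθ => ?_⟩
  · exact ((hF hθ).1.apply_continuousLinearMap z).congr (Filter.Eventually.of_forall (heq θ))
  · rw [(hF hθ).2.fderiv, ContinuousLinearMap.integral_apply (hF hθ).1]
    simp only [heq]

/-- A nonzero measure makes the partition function positive, so its logarithm is smooth. -/
theorem IsInformationFrobeniusManifold.contDiffOn_logPartition
    (hM : IsInformationFrobeniusManifold μ X Θ) : ContDiffOn ℝ ∞ (logPartition μ X) Θ := by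
  have : NeZero μ := ⟨hM.measure_ne_zero⟩
  have h := contDiffOn_integral_exp_stat (f := fun _ => 1) hM.measurable hM.isOpen
    measurable_const fun θ hθ => by simpa using hM.integrable θ hθ
  simp only [one_mul] at h
  exact h.log fun θ hθ => (integral_exp_pos (hM.integrable θ hθ)).ne'

end ExponentialFamilies

/-! ### Structure constants in the dual frame and the two instances of hydrodynamic data. -/

section Potentials

variable {n : ℕ} {Φ : (Fin n → ℝ) → ℝ} {Θ : Set (Fin n → ℝ)} {θ : Fin n → ℝ}

/-- The structure constants `bⁱʲ_k = gⁱᵃ gʲᶜ ∂_a ∂_c ∂_k Φ` of the multiplication in the dual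
frame. -/
noncomputable def structureConst (Φ : (Fin n → ℝ) → ℝ) (θ : Fin n → ℝ) (i j k : Fin n) : ℝ :=
  ∑ a, ∑ c, (metric Φ θ)⁻¹ i a * (metric Φ θ)⁻¹ j c * cubic Φ θ a c k

theorem tmul_dualFrame (Φ : (Fin n → ℝ) → ℝ) (θ : Fin n → ℝ) (i j : Fin n) :
    tmul Φ θ (dualFrame Φ θ i) (dualFrame Φ θ j) =
      ∑ k, structureConst Φ θ i j k • dualFrame Φ θ k := by
  funext m
  simp only [tmul, dualFrame, structureConst, Finset.sum_apply, Pi.smul_apply, smul_eq_mul,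
    Finset.sum_mul]
  conv_rhs => rw [Finset.sum_comm]
  refine Finset.sum_congr rfl fun a _ => ?_
  rw [Finset.sum_comm]

theorem tmul_sum_left {ι : Type*} [Fintype ι] (x : ι → ℝ) (f : ι → Fin n → ℝ) (w : Fin n → ℝ) :
    tmul Φ θ (∑ l, x l • f l) w = ∑ l, x l • tmul Φ θ (f l) w := by
  let L : (Fin n → ℝ) →ₗ[ℝ] (Fin n → ℝ) :=
    { toFun := fun v => tmul Φ θ v w
      map_add' := fun v v' => funext fun k => by
        simp only [tmul, Pi.add_apply, add_mul, Finset.sum_add_distrib]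
      map_smul' := fun r v => funext fun k => by
        simp only [tmul, Pi.smul_apply, smul_eq_mul, RingHom.id_apply, mul_assoc,
          Finset.mul_sum] }
  have h := map_sum L (fun l => x l • f l) Finset.univ
  simp only [map_smul] at h
  exact h

theorem tmul_sum_right {ι : Type*} [Fintype ι] (x : ι → ℝ) (f : ι → Fin n → ℝ) (v : Fin n → ℝ) :
    tmul Φ θ v (∑ l, x l • f l) = ∑ l, x l • tmul Φ θ v (f l) := by
  let L : (Fin n → ℝ) →ₗ[ℝ] (Fin n → ℝ) :=
    { toFun := fun w => tmul Φ θ v w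
      map_add' := fun w w' => funext fun k => by
        simp only [tmul, Pi.add_apply, mul_add, add_mul, Finset.sum_add_distrib]
      map_smul' := fun r w => funext fun k => by
        simp only [tmul, Pi.smul_apply, smul_eq_mul, RingHom.id_apply, Finset.mul_sum]
        refine Finset.sum_congr rfl fun i _ => Finset.sum_congr rfl fun j _ =>
          Finset.sum_congr rfl fun l _ => ?_
        ring }
  have h := map_sum L (fun l => x l • f l) Finset.univ
  simp only [map_smul] at h
  exact h

theorem dualFrame_ext (hg : (metric Φ θ).det ≠ 0) {x y : Fin n → ℝ}
    (h : ∑ k, x k • dualFrame Φ θ k = ∑ k, y k • dualFrame Φ θ k) : x = y := by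
  have hv : ∀ x : Fin n → ℝ, ∑ k, x k • dualFrame Φ θ k = Matrix.vecMul x (metric Φ θ)⁻¹ := by
    intro x
    funext m
    simp [Matrix.vecMul, dotProduct, dualFrame]
  rw [hv, hv] at h
  have h2 := congrArg (fun z => Matrix.vecMul z (metric Φ θ)) h
  simpa only [Matrix.vecMul_vecMul, Matrix.nonsing_inv_mul _ (isUnit_iff_ne_zero.mpr hg),
    Matrix.vecMul_one] using h2

variable (hΘ : IsOpen Θ) (hΦ : ContDiffOn ℝ ∞ Φ Θ)
include hΘ hΦ

theorem contDiffOn_pd (i : Fin n) : ContDiffOn ℝ ∞ (pd i Φ) Θ := dd_contDiffOn hΘ hΦ _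

theorem metric_comm (hθ : θ ∈ Θ) (i j : Fin n) : metric Φ θ i j = metric Φ θ j i :=
  dd_comm hΘ hΦ hθ _ _

theorem cubic_comm_left (hθ : θ ∈ Θ) (i j k : Fin n) : cubic Φ θ i j k = cubic Φ θ j i k :=
  dd_comm hΘ (contDiffOn_pd hΘ hΦ k) hθ _ _

theorem cubic_comm_right (hθ : θ ∈ Θ) (i j k : Fin n) : cubic Φ θ i j k = cubic Φ θ i k j :=
  dd_congr hΘ (fun _ hθ' => dd_comm hΘ hΦ hθ' _ _) hθ _

theorem inv_metric_comm (hθ : θ ∈ Θ) (i j : Fin n) :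
    (metric Φ θ)⁻¹ i j = (metric Φ θ)⁻¹ j i := by
  have h : (metric Φ θ).transpose = metric Φ θ :=
    Matrix.ext fun i j => metric_comm hΘ hΦ hθ j i
  have h2 := Matrix.transpose_nonsing_inv (metric Φ θ)
  rw [h] at h2
  exact congrFun (congrFun h2 j) i

theorem contDiffOn_metric (i j : Fin n) : ContDiffOn ℝ ∞ (fun θ => metric Φ θ i j) Θ :=
  contDiffOn_pd hΘ (contDiffOn_pd hΘ hΦ j) i

omit hΘ hΦ in
theorem contDiffOn_det {A : (Fin n → ℝ) → Matrix (Fin n) (Fin n) ℝ}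
    (hA : ∀ i j, ContDiffOn ℝ ∞ (fun θ => A θ i j) Θ) :
    ContDiffOn ℝ ∞ (fun θ => (A θ).det) Θ := by
  simp only [Matrix.det_apply]
  exact ContDiffOn.sum fun σ _ => ContDiffOn.const_smul _ (contDiffOn_prod fun i _ => hA _ _)

omit hΘ hΦ in
theorem contDiffOn_inv {A : (Fin n → ℝ) → Matrix (Fin n) (Fin n) ℝ}
    (hA : ∀ i j, ContDiffOn ℝ ∞ (fun θ => A θ i j) Θ) (hdet : ∀ θ ∈ Θ, (A θ).det ≠ 0)
    (i j : Fin n) : ContDiffOn ℝ ∞ (fun θ => (A θ)⁻¹ i j) Θ := by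
  simp only [Matrix.inv_def, Ring.inverse_eq_inv', Matrix.smul_apply, smul_eq_mul,
    Matrix.adjugate_apply]
  refine ((contDiffOn_det hA).inv hdet).mul (contDiffOn_det fun k l => ?_)
  by_cases hk : k = j
  · subst hk
    simp only [Matrix.updateRow_self]
    exact contDiffOn_const
  · simp only [Matrix.updateRow_ne hk]
    exact hA k l

theorem structureConst_comm (hθ : θ ∈ Θ) (i j k : Fin n) :
    structureConst Φ θ i j k = structureConst Φ θ j i k := by
  unfold structureConst
  rw [Finset.sum_comm]
  refine Finset.sum_congr rfl fun c _ => Finset.sum_congr rfl fun a _ => ?_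
  rw [cubic_comm_left hΘ hΦ hθ a c]
  ring

/-- Both sides are the totally symmetric tensor `t` with its three indices raised. -/
theorem structureConst_mul_inv_comm (hθ : θ ∈ Θ) (i j m : Fin n) :
    ∑ l, structureConst Φ θ i j l * (metric Φ θ)⁻¹ l m =
      ∑ l, structureConst Φ θ i m l * (metric Φ θ)⁻¹ l j := by
  simp only [structureConst, Finset.sum_mul]
  rw [Finset.sum_comm]
  conv_rhs => rw [Finset.sum_comm]
  refine Finset.sum_congr rfl fun a _ => ?_
  rw [Finset.sum_comm]
  refine Finset.sum_congr rfl fun c _ => Finset.sum_congr rfl fun l _ => ?_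
  rw [cubic_comm_right hΘ hΦ hθ a c l, inv_metric_comm hΘ hΦ hθ l m,
    inv_metric_comm hΘ hΦ hθ j c]
  ring

theorem structureConst_assoc (hθ : θ ∈ Θ) (hg : (metric Φ θ).det ≠ 0)
    (hassoc : ∀ u v w : Fin n → ℝ,
      tmul Φ θ (tmul Φ θ u v) w = tmul Φ θ u (tmul Φ θ v w)) (i j m k : Fin n) :
    ∑ l, structureConst Φ θ i j l * structureConst Φ θ l m k =
      ∑ l, structureConst Φ θ i m l * structureConst Φ θ l j k := by
  -- Associativity in the order `j, i, m` keeps `i` in the middle; with commutativity of `b` in its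
  -- upper indices, comparing coefficients of `∂^k` gives the exchange of `j` and `m`.
  have h := hassoc (dualFrame Φ θ j) (dualFrame Φ θ i) (dualFrame Φ θ m)
  simp only [tmul_dualFrame, tmul_sum_left, tmul_sum_right, Finset.smul_sum, smul_smul] at h
  rw [Finset.sum_comm] at h
  conv_rhs at h => rw [Finset.sum_comm]
  simp only [← Finset.sum_smul] at h
  have h2 := congrFun (dualFrame_ext hg h) k
  simp only [structureConst_comm hΘ hΦ hθ i j, structureConst_comm hΘ hΦ hθ _ j] at h2 ⊢
  exact h2

/-- Differentiating `g⁻¹ g = 1` gives `∂_k g⁻¹ = -g⁻¹ (∂_k g) g⁻¹`, and `∂_k g_{am} = t_{kam}`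
because `g` is a Hessian. -/
theorem pd_inv_metric (hdet : ∀ θ ∈ Θ, (metric Φ θ).det ≠ 0) (hθ : θ ∈ Θ) (i j k : Fin n) :
    pd k (fun θ => (metric Φ θ)⁻¹ i j) θ = -structureConst Φ θ i j k := by
  have hN := contDiffOn_inv (contDiffOn_metric hΘ hΦ) hdet
  have hM := contDiffOn_metric hΘ hΦ
  have hunit := isUnit_iff_ne_zero.mpr (hdet θ hθ)
  let D : Matrix (Fin n) (Fin n) ℝ := Matrix.of fun i j => pd k (fun θ => (metric Φ θ)⁻¹ i j) θ
  let C : Matrix (Fin n) (Fin n) ℝ := Matrix.of fun a m => cubic Φ θ k a m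
  have h0 : D * metric Φ θ + (metric Φ θ)⁻¹ * C = 0 := by
    ext i m
    have h1 : dd (Pi.single k 1) (fun θ => ∑ a, (metric Φ θ)⁻¹ i a * metric Φ θ a m) θ = 0 := by
      have hc : Set.EqOn (fun θ => ∑ a, (metric Φ θ)⁻¹ i a * metric Φ θ a m)
          (fun _ => (1 : Matrix (Fin n) (Fin n) ℝ) i m) Θ := fun θ' hθ' => by
        have := Matrix.nonsing_inv_mul (metric Φ θ') (isUnit_iff_ne_zero.mpr (hdet θ' hθ'))
        rw [← this, Matrix.mul_apply]
      rw [dd_congr hΘ hc hθ]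
      simp [dd]
    rw [dd_sum hΘ (fun a => (hN i a).mul (hM a m)) hθ] at h1
    simp only [dd_mul hΘ (hN i _) (hM _ m) hθ, Finset.sum_add_distrib] at h1
    simp only [Matrix.add_apply, Matrix.mul_apply, Matrix.zero_apply]
    exact h1
  have h1 : D = -((metric Φ θ)⁻¹ * C * (metric Φ θ)⁻¹) := by
    have h2 := congrArg (fun Z => Z * (metric Φ θ)⁻¹) h0
    simp only [add_mul, zero_mul, Matrix.mul_assoc, Matrix.mul_nonsing_inv _ hunit,
      Matrix.mul_one] at h2
    rw [Matrix.mul_assoc]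
    exact eq_neg_of_add_eq_zero_left h2
  have h2 := congrFun (congrFun h1 i) j
  refine h2.trans ?_
  rw [Matrix.neg_apply, Matrix.mul_apply, structureConst, Finset.sum_comm]
  congr 1
  refine Finset.sum_congr rfl fun c _ => ?_
  rw [Matrix.mul_apply, Finset.sum_mul]
  refine Finset.sum_congr rfl fun a _ => ?_
  simp only [C, Matrix.of_apply]
  rw [cubic_comm_left hΘ hΦ hθ k a c, cubic_comm_right hΘ hΦ hθ a k c,
    inv_metric_comm hΘ hΦ hθ c j]
  ring

theorem isHydrodynamicData_metric (hdet : ∀ θ ∈ Θ, (metric Φ θ).det ≠ 0)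
    (hassoc : ∀ θ ∈ Θ, ∀ u v w : Fin n → ℝ,
      tmul Φ θ (tmul Φ θ u v) w = tmul Φ θ u (tmul Φ θ v w)) :
    IsHydrodynamicData Θ (fun θ => (-2 : ℝ) • (metric Φ θ)⁻¹) (structureConst Φ) where
  isOpen := hΘ
  smooth i j := contDiffOn_const.mul (contDiffOn_inv (contDiffOn_metric hΘ hΦ) hdet i j)
  symm θ hθ i j := by
    rw [Matrix.smul_apply, Matrix.smul_apply, inv_metric_comm hΘ hΦ hθ i j]
  pd_eq θ hθ i j k := by
    have h := dd_const_mul hΘ (contDiffOn_inv (contDiffOn_metric hΘ hΦ) hdet i j) hθ (-2)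
      (Pi.single k 1)
    have h2 := pd_inv_metric hΘ hΦ hdet hθ i j k
    change dd _ _ _ = _ at h2
    rw [h2] at h
    refine Eq.trans h ?_
    ring
  mul_h θ hθ i j m := by
    simp only [Matrix.smul_apply, smul_eq_mul, mul_left_comm _ (-2 : ℝ), ← Finset.mul_sum]
    rw [structureConst_mul_inv_comm hΘ hΦ hθ]
  mul_b θ hθ i j m k := structureConst_assoc hΘ hΦ hθ (hdet θ hθ) (hassoc θ hθ) i j m k

theorem isHydrodynamicData_tangent (hθ : θ ∈ Θ) (hg : (metric Φ θ).det ≠ 0)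
    (hassoc : ∀ u v w : Fin n → ℝ,
      tmul Φ θ (tmul Φ θ u v) w = tmul Φ θ u (tmul Φ θ v w)) (s : ℝ) :
    IsHydrodynamicData (Set.univ : Set (Fin n → ℝ))
      (fun w => Matrix.of (fun i j => ∑ k,
        (structureConst Φ θ i j k + structureConst Φ θ j i k) * w k) + s • (metric Φ θ)⁻¹)
      (fun _ => structureConst Φ θ) where
  isOpen := isOpen_univ
  smooth i j := by
    simp only [Matrix.add_apply, Matrix.of_apply, Matrix.smul_apply]
    fun_prop
  symm w _ i j := by
    simp only [Matrix.add_apply, Matrix.of_apply, Matrix.smul_apply,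
      inv_metric_comm hΘ hΦ hθ i j, add_comm (structureConst Φ θ i j _)]
  pd_eq w _ i j k := by
    have h1 : HasFDerivAt (fun w : Fin n → ℝ => ∑ k,
        (structureConst Φ θ i j k + structureConst Φ θ j i k) * w k +
          s • (metric Φ θ)⁻¹ i j) (statFunctional fun k =>
            structureConst Φ θ i j k + structureConst Φ θ j i k) w := by
      have := (statFunctional fun k =>
        structureConst Φ θ i j k + structureConst Φ θ j i k).hasFDerivAt (x := w)
      exact (this.congr_of_eventuallyEq (Filter.Eventually.of_forall fun w =>
        (statFunctional_apply _ w).symm)).add_const _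
    have h2 : pd k (fun w : Fin n → ℝ => ∑ k,
        (structureConst Φ θ i j k + structureConst Φ θ j i k) * w k +
          s • (metric Φ θ)⁻¹ i j) w = 2 * structureConst Φ θ i j k := by
      rw [pd, h1.fderiv, statFunctional_apply]
      simp only [Pi.single_apply, mul_ite, mul_one, mul_zero, Finset.sum_ite_eq',
        Finset.mem_univ, if_true, structureConst_comm hΘ hΦ hθ j i]
      ring
    exact h2
  mul_h w _ i j m := by
    -- Contracting `b` with the affine tensor gives `2 b b w + s b g⁻¹`, and both parts are
    -- symmetric in `j` and `m`.
    have key : ∀ j m, ∑ l, structureConst Φ θ i j l *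
        (∑ k, (structureConst Φ θ l m k + structureConst Φ θ m l k) * w k +
          s * (metric Φ θ)⁻¹ l m) =
        2 * ∑ k, (∑ l, structureConst Φ θ i j l * structureConst Φ θ l m k) * w k +
          s * ∑ l, structureConst Φ θ i j l * (metric Φ θ)⁻¹ l m := by
      intro j m
      simp only [structureConst_comm hΘ hΦ hθ m, mul_add, Finset.sum_add_distrib,
        Finset.mul_sum, Finset.sum_mul]
      congr 1
      · rw [Finset.sum_comm]
        refine Finset.sum_congr rfl fun k _ => Finset.sum_congr rfl fun l _ => ?_
        ring
      · exact Finset.sum_congr rfl fun l _ => by ring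
    simp only [Matrix.add_apply, Matrix.of_apply, Matrix.smul_apply, smul_eq_mul]
    rw [key, key, structureConst_mul_inv_comm hΘ hΦ hθ i j m]
    simp only [structureConst_assoc hΘ hΦ hθ hg hassoc i j m]
  mul_b _ _ i j m k := structureConst_assoc hΘ hΦ hθ hg hassoc i j m k

end Potentials

end InfoFrobenius

theorem mainTheorem4 {n : ℕ} {S : Type*} [MeasurableSpace S] (μ : MeasureTheory.Measure S)
    (X : Fin n → S → ℝ) (Θ : Set (Fin n → ℝ))
    (hM : InfoFrobenius.IsInformationFrobeniusManifold μ X Θ) :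
    ∃ b : (Fin n → ℝ) → Fin n → Fin n → Fin n → ℝ,
      -- at each point, the numbers `b` are the structure constants of the Frobenius algebra
      (∀ θ ∈ Θ, ∀ i j,
        InfoFrobenius.tmul (InfoFrobenius.logPartition μ X) θ
            (InfoFrobenius.dualFrame (InfoFrobenius.logPartition μ X) θ i)
            (InfoFrobenius.dualFrame (InfoFrobenius.logPartition μ X) θ j) =
          ∑ k, b θ i j k • InfoFrobenius.dualFrame (InfoFrobenius.logPartition μ X) θ k) ∧
      -- the bracket for fields with values in the manifold
      (∃ br : InfoFrobenius.smoothFunctionals Θ →ₗ[ℝ] InfoFrobenius.smoothFunctionals Θ →ₗ[ℝ]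
          InfoFrobenius.smoothFunctionals Θ,
        InfoFrobenius.IsPoissonBracket br ∧
        InfoFrobenius.IsHydrodynamicType
          (fun θ => (-2 : ℝ) • (InfoFrobenius.metric (InfoFrobenius.logPartition μ X) θ)⁻¹)
          b br) ∧
      -- the linear brackets at each point, for fields with values in the tangent space
      (∀ p ∈ Θ, ∀ s : ℝ,
        ∃ br : InfoFrobenius.smoothFunctionals (Set.univ : Set (Fin n → ℝ)) →ₗ[ℝ]
            InfoFrobenius.smoothFunctionals (Set.univ : Set (Fin n → ℝ)) →ₗ[ℝ]
            InfoFrobenius.smoothFunctionals (Set.univ : Set (Fin n → ℝ)),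
          InfoFrobenius.IsPoissonBracket br ∧
          InfoFrobenius.IsHydrodynamicType
            (fun w => Matrix.of (fun i j => ∑ k, (b p i j k + b p j i k) * w k) +
              s • (InfoFrobenius.metric (InfoFrobenius.logPartition μ X) p)⁻¹)
            (fun _ => b p) br) := by
  have hΘ := hM.isOpen
  have hΦ := hM.contDiffOn_logPartition
  have h1 := InfoFrobenius.isHydrodynamicData_metric hΘ hΦ hM.nondegenerate hM.associative
  refine ⟨InfoFrobenius.structureConst (InfoFrobenius.logPartition μ X),
    fun θ _ i j => InfoFrobenius.tmul_dualFrame _ θ i j,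
    ⟨InfoFrobenius.bracket h1, InfoFrobenius.isPoissonBracket_bracket h1,
      InfoFrobenius.isHydrodynamicType_bracket h1⟩, fun p hp s => ?_⟩
  have h2 := InfoFrobenius.isHydrodynamicData_tangent hΘ hΦ hp (hM.nondegenerate p hp)
    (hM.associative p hp) s
  exact ⟨InfoFrobenius.bracket h2, InfoFrobenius.isPoissonBracket_bracket h2,
    InfoFrobenius.isHydrodynamicType_bracket h2⟩
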